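/- Let $\mathscr H$ and $\mathscr K$ be arbitrary (not necessarily separable) complex Hilbert spaces, let $(X,\Sigma_X)$ and $(Y,\Sigma_Y)$ be nonempty measurable spaces, and let $E:\Sigma_X\to\mathfrak B(\mathscr H)$ and $F:\Sigma_Y\to\mathfrak B(\mathscr K)$ be projection-valued measures. Let $\mathfrak S_2$ and $\mathfrak S_1$ denote the Hilbert-Schmidt and trace-class operators. Let $\mathcal G$ be the unique projection-valued measure on the product $\sigma$-algebra of $X\times Y$, acting on the Hilbert space $\mathfrak S_2(\mathscr K,\mathscr H)$, with $\mathcal G(\Gamma\times\Delta)T=E(\Gamma)TF(\Delta)$ for all $\Gamma\in\Sigma_X$, $\Delta\in\Sigma_Y$, and let $\widetilde{\mathcal G}$ be the unique projection-valued measure on $Y\times X$, acting on $\mathfrak S_2(\mathscr H,\mathscr K)$, with $\widetilde{\mathcal G}(\Delta\times\Gamma)R=F(\Delta)RE(\Gamma)$. Let $\mathfrak M$ be the set of bounded measurable functions $\phi:X\times Y\to\mathbb C$ (modulo equality $\mathcal G$-a.e.) for which there are a measurable space $(Z,\Sigma_Z)$ with a finite positive measure $\nu$ and bounded measurable functions $\alpha:X\times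 Z\to\mathbb C$, $\beta:Y\times Z\to\mathbb C$ such that $\phi(x,y)=\int_Z\alpha(x,z)\beta(y,z)\,d\nu(z)$ for $\mathcal G$-a.e. $(x,y)$. For $\phi\in\mathfrak M$ put $\widetilde\phi(y,x)=\phi(x,y)$. Let $\phi\in\mathfrak M$. For every $T\in\mathfrak B(\mathscr K,\mathscr H)$ there is a unique operator $\int\phi\,d\mathcal G\,T\in\mathfrak B(\mathscr K,\mathscr H)$ such that $$\operatorname{Tr}\Big(R\int\phi\,d\mathcal G\,T\Big)=\operatorname{Tr}\Big(T\int\widetilde\phi\,d\widetilde{\mathcal G}\,R\Big)\qquad\text{for all }R\in\mathfrak S_1(\mathscr H,\mathscr K),$$ and the map $\int\phi\,d\mathcal G:\mathfrak B(\mathscr K,\mathscr H)\to\mathfrak B(\mathscr K,\mathscr H)$ so defined is sequentially continuous in the strong operator topology: if $(T_n)_{n\in\mathbb N}$ is a sequence in $\mathfrak B(\mathscr K,\mathscr H)$ converging to $T\in\mathfrak B(\mathscr K,\mathscr H)$ in the strong operator topology, then $\int\phi\,d\mathcal G\,T_n\to\int\phi\,d\mathcal G\,T$ in the strong operator topology.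 -/

import Mathlib

open MeasureTheory Filter Topology

universe w u₁ u₂ u₃ u₄

noncomputable section

/-! ### Projection-valued measures -/

/-- A projection-valued measure on a measurable space `X`, acting on the Hilbert space `H`:
orthogonal projections, normalized by `E X = 1`, countably additive in the strong operator
topology. As for Mathlib's vector measures, the value on a non-measurable set is `0` by
convention. -/
structure PVM (X : Type*) [MeasurableSpace X] (H : Type*) [NormedAddCommGroup H]
    [InnerProductSpace ℂ H] [CompleteSpace H] where
  /-- The projection attached to a set. -/
  proj : Set X → H →L[ℂ] H
  isStarProjection : ∀ s, IsStarProjection (proj s)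
  proj_univ : proj Set.univ = 1
  proj_of_not_measurableSet : ∀ s, ¬ MeasurableSet s → proj s = 0
  hasSum_proj : ∀ f : ℕ → Set X, (∀ i, MeasurableSet (f i)) →
    Pairwise (Function.onFun Disjoint f) →
    ∀ v : H, HasSum (fun i => proj (f i) v) (proj (⋃ i, f i) v)

namespace PVM

variable {X : Type*} [MeasurableSpace X] {H : Type*} [NormedAddCommGroup H]
  [InnerProductSpace ℂ H] [CompleteSpace H]

theorem proj_empty (E : PVM X H) : E.proj ∅ = 0 := by
  ext v
  have h := E.hasSum_proj (fun _ => ∅) (fun _ => MeasurableSet.empty)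
    (fun _ _ _ => by simp [Function.onFun]) v
  have h0 := h.summable.tendsto_atTop_zero
  simpa using tendsto_nhds_unique tendsto_const_nhds h0

theorem re_inner_proj_nonneg (E : PVM X H) (s : Set X) (v : H) :
    0 ≤ (inner ℂ v (E.proj s v)).re := by
  have hid : E.proj s (E.proj s v) = E.proj s v := by
    have := congrArg (fun A : H →L[ℂ] H => A v) (E.isStarProjection s).isIdempotentElem
    simpa using this
  have hsa := (E.isStarProjection s).isSelfAdjoint.isSymmetric v (E.proj s v)
  have h2 : inner ℂ v (E.proj s v) = inner ℂ (E.proj s v) (E.proj s v) := by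
    have h3 : inner ℂ (E.proj s v) (E.proj s v) = inner ℂ v (E.proj s (E.proj s v)) := hsa
    rw [h3, hid]
  rw [h2]
  exact inner_self_nonneg (𝕜 := ℂ)

/-- The finite positive measure `E_{v,v} : s ↦ ⟪v, E(s) v⟫`. -/
def diag (E : PVM X H) (v : H) : Measure X :=
  Measure.ofMeasurable (fun s _ => ENNReal.ofReal (inner ℂ v (E.proj s v)).re)
    (by simp [E.proj_empty])
    (by
      intro f hf hd
      have h1 : HasSum (fun i => inner ℂ v (E.proj (f i) v))
          (inner ℂ v (E.proj (⋃ i, f i) v)) :=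
        (E.hasSum_proj f hf hd v).mapL (innerSL ℂ v)
      have h2 := Complex.hasSum_re h1
      rw [← h2.tsum_eq,
        ENNReal.ofReal_tsum_of_nonneg (fun i => E.re_inner_proj_nonneg (f i) v) h2.summable])

/-- `A = ∫ f dE`: the operator with `⟪v, A v⟫ = ∫ f dE_{v,v}` for all `v`. By polarization this
is the same as `⟪u, A v⟫ = ∫ f dE_{u,v}` for all `u`, `v`, and `A` is unique. -/
def IsIntegral (E : PVM X H) (f : X → ℂ) (A : H →L[ℂ] H) : Prop :=
  ∀ v : H, inner ℂ v (A v) = ∫ x, f x ∂(E.diag v)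

/-- The integral `∫ f dE` of a bounded measurable function against a projection-valued measure:
the unique operator satisfying `E.IsIntegral f`. -/
def integral (E : PVM X H) (f : X → ℂ) : H →L[ℂ] H :=
  Classical.epsilon (E.IsIntegral f)

/-- `p` holds `E`-almost everywhere: it holds off a measurable set `N` with `E(N) = 0`. -/
def AlmostEverywhere (E : PVM X H) (p : X → Prop) : Prop :=
  ∃ N : Set X, MeasurableSet N ∧ E.proj N = 0 ∧ ∀ x, x ∉ N → p x

open Classical in
/-- Point masses show that projection-valued measures exist on every nonempty space. -/
instance [Nonempty X] : Nonempty (PVM X H) :=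
  ⟨{ proj := fun s => if MeasurableSet s ∧ Classical.arbitrary X ∈ s then 1 else 0
     isStarProjection := by
       intro s
       split_ifs
       · exact IsStarProjection.one _
       · exact IsStarProjection.zero _
     proj_univ := by simp
     proj_of_not_measurableSet := by
       intro s hs
       simp [hs]
     hasSum_proj := by
       intro f hf hd v
       by_cases h : ∃ i, Classical.arbitrary X ∈ f i
       · obtain ⟨i, hi⟩ := h
         have hU : Classical.arbitrary X ∈ ⋃ i, f i := Set.mem_iUnion.2 ⟨i, hi⟩
         rw [if_pos ⟨MeasurableSet.iUnion hf, hU⟩]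
         have := hasSum_single (f := fun j =>
           (if MeasurableSet (f j) ∧ Classical.arbitrary X ∈ f j then
             (1 : H →L[ℂ] H) else 0) v) i (by
             intro j hj
             have : Classical.arbitrary X ∉ f j := fun hj' =>
               Set.disjoint_left.1 (hd hj) hj' hi
             simp [this])
         simpa [hf i, hi] using this
       · have hU : Classical.arbitrary X ∉ ⋃ i, f i := by simpa using h
         push Not at h
         simp [h] }⟩

end PVM

/-! ### Hilbert-Schmidt operators, trace-class operators, the trace -/

section Operators

variable (K : Type*) [NormedAddCommGroup K] [InnerProductSpace ℂ K] [CompleteSpace K]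
  (H : Type*) [NormedAddCommGroup H] [InnerProductSpace ℂ H]

/-- The index set of a fixed Hilbert basis of `K`. -/
def hilbertIndex : Set K := (exists_hilbertBasis ℂ K).choose

/-- A fixed Hilbert basis of `K`. The notions below do not depend on its choice. -/
def stdBasis : HilbertBasis (hilbertIndex K) ℂ K :=
  (exists_hilbertBasis ℂ K).choose_spec.choose

variable {K H}

/-- `T` is a Hilbert-Schmidt operator: `∑ᵢ ‖T eᵢ‖² < ∞`. -/
def IsHilbertSchmidt (T : K →L[ℂ] H) : Prop :=
  Summable fun i => ‖T (stdBasis K i)‖ ^ 2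

theorem isHilbertSchmidt_iff_memlp (T : K →L[ℂ] H) :
    IsHilbertSchmidt T ↔ Memℓp (fun i => T (stdBasis K i)) 2 := by
  rw [memℓp_gen_iff (by norm_num)]
  simp [IsHilbertSchmidt]

variable (K H) in
/-- The linear subspace of Hilbert-Schmidt operators. -/
def hilbertSchmidtSubmodule : Submodule ℂ (K →L[ℂ] H) where
  carrier := {T | IsHilbertSchmidt T}
  zero_mem' := by simp [IsHilbertSchmidt, summable_zero]
  add_mem' := by
    intro S T hS hT
    exact (isHilbertSchmidt_iff_memlp _).2
      (((isHilbertSchmidt_iff_memlp S).1 hS).add ((isHilbertSchmidt_iff_memlp T).1 hT))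
  smul_mem' := by
    intro c T hT
    exact (isHilbertSchmidt_iff_memlp _).2
      (((isHilbertSchmidt_iff_memlp T).1 hT).const_smul c)

variable (K H) in
/-- The Hilbert space `𝔖₂(K, H)` of Hilbert-Schmidt operators `K → H`. It is a type of its own
because its norm is the Hilbert-Schmidt norm and not the operator norm. -/
def HilbertSchmidt : Type _ := hilbertSchmidtSubmodule K H

namespace HilbertSchmidt

instance : AddCommGroup (HilbertSchmidt K H) :=
  inferInstanceAs (AddCommGroup (hilbertSchmidtSubmodule K H))

instance : Module ℂ (HilbertSchmidt K H) :=
  inferInstanceAs (Module ℂ (hilbertSchmidtSubmodule K H))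

/-- The underlying bounded operator of a Hilbert-Schmidt operator. -/
def toCLM : HilbertSchmidt K H →ₗ[ℂ] (K →L[ℂ] H) := (hilbertSchmidtSubmodule K H).subtype

theorem toCLM_injective : Function.Injective (toCLM : HilbertSchmidt K H → (K →L[ℂ] H)) :=
  Subtype.val_injective

theorem isHilbertSchmidt (T : HilbertSchmidt K H) : IsHilbertSchmidt (toCLM T) := T.2

/-- The columns `(T eᵢ)ᵢ` of a Hilbert-Schmidt operator, as an element of `ℓ²`. -/
def columns : HilbertSchmidt K H →ₗ[ℂ] lp (fun _ : hilbertIndex K => H) 2 where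
  toFun T := ⟨fun i => toCLM T (stdBasis K i),
    (isHilbertSchmidt_iff_memlp _).1 T.isHilbertSchmidt⟩
  map_add' S T := by
    ext i
    simp only [map_add]
    rfl
  map_smul' c T := by
    ext i
    simp

theorem columns_apply (T : HilbertSchmidt K H) (i : hilbertIndex K) :
    columns T i = toCLM T (stdBasis K i) := rfl

theorem clm_ext_stdBasis {S T : K →L[ℂ] H}
    (h : ∀ i, S (stdBasis K i) = T (stdBasis K i)) : S = T := by
  refine ContinuousLinearMap.ext_on
    (s := Set.range (stdBasis K)) ?_ ?_
  · have := (stdBasis K).dense_span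
    rw [Submodule.dense_iff_topologicalClosure_eq_top]
    exact this
  · rintro _ ⟨i, rfl⟩
    exact h i

theorem columns_injective :
    Function.Injective (columns : HilbertSchmidt K H →
      lp (fun _ : hilbertIndex K => H) 2) := by
  intro S T h
  refine toCLM_injective (clm_ext_stdBasis fun i => ?_)
  rw [← columns_apply, ← columns_apply, h]

/-- The Hilbert-Schmidt inner product `⟪S, T⟫ = ∑ᵢ ⟪S eᵢ, T eᵢ⟫ = Tr (S* T)`. -/
@[reducible] def innerCore : InnerProductSpace.Core ℂ (HilbertSchmidt K H) where
  inner S T := ∑' i, inner ℂ (toCLM S (stdBasis K i)) (toCLM T (stdBasis K i))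
  conj_inner_symm S T := inner_conj_symm (𝕜 := ℂ) (columns S) (columns T)
  re_inner_nonneg T := inner_self_nonneg (𝕜 := ℂ) (x := columns T)
  add_left S T R := by
    have := inner_add_left (𝕜 := ℂ) (columns S) (columns T) (columns R)
    rw [← map_add] at this
    exact this
  smul_left S T c := by
    have := inner_smul_left (𝕜 := ℂ) (columns S) (columns T) c
    rw [← map_smul] at this
    exact this
  definite T h := by
    have h1 : columns T = 0 := inner_self_eq_zero (𝕜 := ℂ).1 h
    exact columns_injective (h1.trans (map_zero _).symm)

instance : NormedAddCommGroup (HilbertSchmidt K H) :=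
  (innerCore (K := K) (H := H)).toNormedAddCommGroup

instance : InnerProductSpace ℂ (HilbertSchmidt K H) :=
  InnerProductSpace.ofCore (innerCore (K := K) (H := H)).toCore

theorem inner_def (S T : HilbertSchmidt K H) :
    inner ℂ S T = ∑' i, inner ℂ (toCLM S (stdBasis K i)) (toCLM T (stdBasis K i)) := rfl

theorem norm_columns (T : HilbertSchmidt K H) : ‖columns T‖ = ‖T‖ := by
  have h : inner ℂ (columns T) (columns T) = inner ℂ T T := rfl
  rw [@norm_eq_sqrt_re_inner ℂ, @norm_eq_sqrt_re_inner ℂ _ _ _ _ T, h]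

theorem norm_adjoint_apply_le [CompleteSpace H] (T : HilbertSchmidt K H) (y : H) :
    ‖ContinuousLinearMap.adjoint (toCLM T) y‖ ≤ ‖T‖ * ‖y‖ := by
  have h1 : HasSum (fun i => ‖inner ℂ (stdBasis K i)
      (ContinuousLinearMap.adjoint (toCLM T) y)‖ ^ 2)
      (‖ContinuousLinearMap.adjoint (toCLM T) y‖ ^ 2) := by
    have h := Complex.hasSum_re ((stdBasis K).hasSum_inner_mul_inner
      (ContinuousLinearMap.adjoint (toCLM T) y) (ContinuousLinearMap.adjoint (toCLM T) y))
    have h2 : (inner ℂ (ContinuousLinearMap.adjoint (toCLM T) y)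
        (ContinuousLinearMap.adjoint (toCLM T) y)).re
        = ‖ContinuousLinearMap.adjoint (toCLM T) y‖ ^ 2 :=
      inner_self_eq_norm_sq (𝕜 := ℂ) _
    rw [h2] at h
    refine h.congr_fun fun i => ?_
    rw [← inner_conj_symm, RCLike.norm_conj, Complex.mul_conj, Complex.normSq_eq_norm_sq,
      Complex.ofReal_re]
  have h3 : HasSum (fun i => ‖columns T i‖ ^ 2) (‖T‖ ^ 2) := by
    have h := lp.hasSum_norm (p := 2) (by norm_num) (columns T)
    rw [norm_columns] at h
    simpa using h
  have h4 : ‖ContinuousLinearMap.adjoint (toCLM T) y‖ ^ 2 ≤ (‖T‖ * ‖y‖) ^ 2 := by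
    rw [mul_pow]
    refine hasSum_le (fun i => ?_) h1 (h3.mul_right (‖y‖ ^ 2))
    rw [ContinuousLinearMap.adjoint_inner_right, ← mul_pow, columns_apply]
    gcongr
    exact norm_inner_le_norm _ _
  exact (sq_le_sq₀ (norm_nonneg _) (by positivity)).1 h4

theorem norm_toCLM_le [CompleteSpace H] (T : HilbertSchmidt K H) : ‖toCLM T‖ ≤ ‖T‖ := by
  rw [← LinearIsometryEquiv.norm_map ContinuousLinearMap.adjoint (toCLM T)]
  exact ContinuousLinearMap.opNorm_le_bound _ (norm_nonneg _) (norm_adjoint_apply_le T)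

instance [CompleteSpace H] : CompleteSpace (HilbertSchmidt K H) := by
  refine Metric.complete_of_cauchySeq_tendsto fun u hu => ?_
  have hclm : CauchySeq fun n => toCLM (u n) :=
    (toCLM.mkContinuous 1 (fun T => by simpa using norm_toCLM_le T)
      : HilbertSchmidt K H →L[ℂ] (K →L[ℂ] H)).uniformContinuous.comp_cauchySeq hu
  have hcol : CauchySeq fun n => columns (u n) :=
    (columns.mkContinuous 1 (fun T => by simp [norm_columns])
      : HilbertSchmidt K H →L[ℂ]
        lp (fun _ : hilbertIndex K => H) 2).uniformContinuous.comp_cauchySeq hu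
  obtain ⟨A, hA⟩ := cauchySeq_tendsto_of_complete hclm
  obtain ⟨c, hc⟩ := cauchySeq_tendsto_of_complete hcol
  have hAc : ∀ i, A (stdBasis K i) = c i := by
    intro i
    have h1 : Tendsto (fun n => toCLM (u n) (stdBasis K i)) atTop (𝓝 (A (stdBasis K i))) :=
      ((ContinuousLinearMap.apply ℂ H (stdBasis K i)).continuous.tendsto A).comp hA
    have h2 : Tendsto (fun n => columns (u n) i) atTop (𝓝 (c i)) := by
      rw [tendsto_iff_norm_sub_tendsto_zero] at hc ⊢
      refine squeeze_zero (fun _ => norm_nonneg _) (fun n => ?_) hc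
      exact lp.norm_apply_le_norm (by norm_num) (columns (u n) - c) i
    exact tendsto_nhds_unique h1 h2
  have hHS : IsHilbertSchmidt A := by
    rw [isHilbertSchmidt_iff_memlp]
    simp only [hAc]
    exact lp.memℓp c
  let L : HilbertSchmidt K H := ⟨A, hHS⟩
  have hL : columns L = c := by
    ext i
    exact hAc i
  refine ⟨L, ?_⟩
  rw [tendsto_iff_norm_sub_tendsto_zero] at hc ⊢
  refine hc.congr fun n => ?_
  rw [← norm_columns, map_sub, hL]

end HilbertSchmidt

/-- `T` is a trace-class operator: `Tr |T| = ∑ᵢ ⟪eᵢ, |T| eᵢ⟫ < ∞`, where `|T| = (T* T)^(1/2)`. -/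
def IsTraceClass [CompleteSpace H] (T : K →L[ℂ] H) : Prop :=
  Summable fun i => (inner ℂ (stdBasis K i)
    (CFC.sqrt (ContinuousLinearMap.adjoint T ∘L T) (stdBasis K i))).re

/-- The trace `Tr A = ∑ᵢ ⟪eᵢ, A eᵢ⟫` of a trace-class operator. -/
def opTrace (A : K →L[ℂ] K) : ℂ :=
  ∑' i, inner ℂ (stdBasis K i) (A (stdBasis K i))

end Operators

/-! ### Double operator integrals -/

section DoubleOperatorIntegral

variable {X Y : Type*} [MeasurableSpace X] [MeasurableSpace Y]
  {H K : Type*} [NormedAddCommGroup H] [InnerProductSpace ℂ H] [CompleteSpace H]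
  [NormedAddCommGroup K] [InnerProductSpace ℂ K] [CompleteSpace K]

/-- `G` is the projection-valued measure on `X × Y`, acting on `𝔖₂(K, H)`, with
`G(Γ × Δ) T = E(Γ) T F(Δ)` on measurable rectangles. -/
def IsDoublePVM (E : PVM X H) (F : PVM Y K) (G : PVM (X × Y) (HilbertSchmidt K H)) : Prop :=
  ∀ (Γ : Set X) (Δ : Set Y), MeasurableSet Γ → MeasurableSet Δ →
    ∀ T : HilbertSchmidt K H, HilbertSchmidt.toCLM (G.proj (Γ ×ˢ Δ) T) =
      E.proj Γ ∘L HilbertSchmidt.toCLM T ∘L F.proj Δ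

/-- The unique projection-valued measure `G` on `X × Y` with `IsDoublePVM E F G`. -/
def doublePVM [Nonempty X] [Nonempty Y] (E : PVM X H) (F : PVM Y K) :
    PVM (X × Y) (HilbertSchmidt K H) :=
  Classical.epsilon (IsDoublePVM E F)

/-- `(Z, ν, α, β)` is a decomposition of `φ`: the measure `ν` is finite and positive, `α` and `β`
are bounded and measurable, and `φ(x, y) = ∫ α(x, z) β(y, z) dν(z)` for `G`-almost all `(x, y)`. -/
structure IsDecomposition [Nonempty X] [Nonempty Y] (E : PVM X H) (F : PVM Y K) (φ : X × Y → ℂ)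
    {Z : Type*} [MeasurableSpace Z] (ν : Measure Z) (α : X × Z → ℂ) (β : Y × Z → ℂ) : Prop where
  finite : IsFiniteMeasure ν
  measurable_left : Measurable α
  bounded_left : ∃ C : ℝ, ∀ p, ‖α p‖ ≤ C
  measurable_right : Measurable β
  bounded_right : ∃ C : ℝ, ∀ p, ‖β p‖ ≤ C
  eq_integral : (doublePVM E F).AlmostEverywhere
    fun p => φ p = ∫ z, α (p.1, z) * β (p.2, z) ∂ν

/-- The function space `𝔐`, through representatives: the bounded measurable functions on `X × Y`
which admit a decomposition (over a measure space in any fixed universe `w`). -/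
structure MemIntegralProjective {X : Type u₁} {Y : Type u₂}
    [MeasurableSpace X] [MeasurableSpace Y] [Nonempty X] [Nonempty Y]
    {H : Type u₃} {K : Type u₄} [NormedAddCommGroup H] [InnerProductSpace ℂ H] [CompleteSpace H]
    [NormedAddCommGroup K] [InnerProductSpace ℂ K] [CompleteSpace K]
    (E : PVM X H) (F : PVM Y K) (φ : X × Y → ℂ) : Prop where
  measurable : Measurable φ
  bounded : ∃ C : ℝ, ∀ p, ‖φ p‖ ≤ C
  exists_decomposition : ∃ (Z : Type w) (_ : MeasurableSpace Z) (ν : Measure Z)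
    (α : X × Z → ℂ) (β : Y × Z → ℂ), IsDecomposition E F φ ν α β

/-- `D = ∫ φ dG T`, for a bounded operator `T : K → H`: the duality relation
`Tr (R D) = Tr (T (∫ φ' dG' R))` holds for all trace-class `R : H → K`. Here `φ'(y, x) = φ(x, y)`
and `G'` is the projection-valued measure on `Y × X`, acting on `𝔖₂(H, K)`, with
`G'(Δ × Γ) R = F(Δ) R E(Γ)`. -/
def IsDoubleOperatorIntegral [Nonempty X] [Nonempty Y] (E : PVM X H) (F : PVM Y K)
    (φ : X × Y → ℂ) (T D : K →L[ℂ] H) : Prop :=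
  ∀ R : HilbertSchmidt H K, IsTraceClass (HilbertSchmidt.toCLM R) →
    opTrace (HilbertSchmidt.toCLM R ∘L D) =
      opTrace (T ∘L HilbertSchmidt.toCLM ((doublePVM F E).integral (φ ∘ Prod.swap) R))

/-- The double operator integral `∫ φ dG T` of a bounded operator `T : K → H`: the unique operator
satisfying the duality relation. -/
def doubleOperatorIntegral [Nonempty X] [Nonempty Y] (E : PVM X H) (F : PVM Y K)
    (φ : X × Y → ℂ) (T : K →L[ℂ] H) : K →L[ℂ] H :=
  Classical.epsilon (IsDoubleOperatorIntegral E F φ T)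

end DoubleOperatorIntegral

end

/-! Write `φ(x, y) = ∫ α(x, z) β(y, z) dν(z)` and put `A(z) = ∫ α(·, z) dE`, `B(z) = ∫ β(·, z) dF`.
The double operator integral is the average `D T = ∫ A(z) T B(z) dν(z)`, taken vector by vector as a
Bochner integral. This formula makes sense for every bounded `T`. If `T n → T₀` strongly,
Banach-Steinhaus bounds `‖T n‖`, and dominated convergence in `z` gives `D (T n) v → D T₀ v`
(`IsMeasurableFamily.tendsto_average`).

It remains to show that `D T` is characterized by the trace duality. Uniqueness follows by testing
on rank-one operators `R`, since `Tr (|w⟩⟨s| D) = ⟪s, D w⟫`. For existence let `P` be the integral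
of the transposed symbol on `𝔖₂(H, K)`. On a rank-one operator `|w⟩⟨s|` the diagonal measure of the
transposed double measure is the product `F_{w,w} × E_{s,s}` (`IsDoublePVM.diag_rankOne`), so Fubini
turns the quadratic form of `P` into `∫ ⟪s, A(z) s⟫ ⟪w, B(z) w⟫ dν(z)`
(`IsDecomposition.inner_rankOne_integral`). Polarizing in both vectors gives all matrix coefficients
of `P` between rank-one operators. A trace-class `R` is an absolutely convergent sum of rank-one
operators (polar decomposition and a square root of `|R|`), so both traces become double series that
agree term by term after Parseval is applied under the integral sign
(`IsMeasurableFamily.opTrace_average`). Orthonormal bases may be uncountable, but a strongly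
measurable function has separable range and meets only countably many basis vectors.

The double measure is defined by choice, so its existence has to be proved. Finite combinations of
rectangles form a *-algebra with an operator-valued integral, and on `|x⟩⟨y|` the norms of these
operators are `L²` norms for `E_{x,x} × F_{y,y}`. Approximating a measurable set by sets of this
algebra, simultaneously for finitely many such product measures, yields a net of projections with a
strong limit (`exists_isStarProjection_inner_rankOne`). Only the formula on rectangles is used
afterwards, so the choice of measure is immaterial. -/

noncomputable section

/-! ### Polarization -/

/-- A sesquilinear form on a complex vector space which vanishes on the diagonal is zero. -/
theorem sesquilinear_eq_zero_of_diag {V : Type*} [AddCommGroup V] [Module ℂ V] (f : V → V → ℂ)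
    (hl : ∀ u u' v, f (u + u') v = f u v + f u' v)
    (hr : ∀ u v v', f u (v + v') = f u v + f u v')
    (hsl : ∀ (c : ℂ) u v, f (c • u) v = starRingEnd ℂ c * f u v)
    (hsr : ∀ (c : ℂ) u v, f u (c • v) = c * f u v)
    (h : ∀ v, f v v = 0) (u v : V) : f u v = 0 := by
  have h1 := h (u + v)
  have h2 := h (u + Complex.I • v)
  simp only [hl, hr, hsl, hsr, h, Complex.conj_I] at h1 h2
  linear_combination h1 / 2 - Complex.I / 2 * h2 + (f u v / 2 - f v u / 2) * Complex.I_sq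

/-- The norm of an operator is at most twice its numerical radius. -/
theorem ContinuousLinearMap.opNorm_le_two_mul_of_norm_inner_self_le {H : Type*}
    [NormedAddCommGroup H] [InnerProductSpace ℂ H] (A : H →L[ℂ] H) {c : ℝ} (hc : 0 ≤ c)
    (h : ∀ v, ‖inner ℂ v (A v)‖ ≤ c * ‖v‖ ^ 2) : ‖A‖ ≤ 2 * c := by
  have key : ∀ u v : H, ‖u‖ = 1 → ‖v‖ = 1 → ‖inner ℂ u (A v)‖ ≤ 2 * c := by
    intro u v hu hv
    have e : (4 : ℂ) * inner ℂ u (A v) = inner ℂ (u + v) (A (u + v))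
        - inner ℂ (u - v) (A (u - v))
        - Complex.I * inner ℂ (u + Complex.I • v) (A (u + Complex.I • v))
        + Complex.I * inner ℂ (u - Complex.I • v) (A (u - Complex.I • v)) := by
      simp only [map_add, map_sub, map_smul, inner_add_left, inner_add_right, inner_sub_left,
        inner_sub_right, inner_smul_left, inner_smul_right, Complex.conj_I]
      linear_combination (2 * inner ℂ u (A v) - 2 * inner ℂ v (A u)) * Complex.I_sq
    -- For unit vectors each parallelogram law bounds two of the four squared norms by a total of 4,
    -- so `4 ‖⟪u, A v⟫‖ ≤ 8 c`.
    have p1 := parallelogram_law_with_norm ℂ u v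
    have p2 := parallelogram_law_with_norm ℂ u (Complex.I • v)
    rw [norm_smul, Complex.norm_I, hu, hv] at p2
    rw [hu, hv] at p1
    have h4 : ‖(4 : ℂ) * inner ℂ u (A v)‖ ≤ c * ‖u + v‖ ^ 2 + c * ‖u - v‖ ^ 2
        + c * ‖u + Complex.I • v‖ ^ 2 + c * ‖u - Complex.I • v‖ ^ 2 := by
      rw [e]
      refine (norm_add_le _ _).trans (add_le_add ((norm_sub_le _ _).trans
        (add_le_add ((norm_sub_le _ _).trans (add_le_add (h _) (h _))) ?_)) ?_) <;>
      · rw [norm_mul, Complex.norm_I, one_mul]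
        exact h _
    rw [norm_mul] at h4
    norm_num at h4
    nlinarith
  refine ContinuousLinearMap.opNorm_le_of_unit_norm (𝕜 := ℝ) (f := A.restrictScalars ℝ)
    (by positivity) fun v hv => ?_
  rw [ContinuousLinearMap.coe_restrictScalars']
  by_cases h0 : A v = 0
  · rw [h0, norm_zero]
    positivity
  have hn : ‖A v‖ ≠ 0 := norm_ne_zero_iff.2 h0
  have := key ((‖A v‖⁻¹ : ℂ) • A v) v (by simp [norm_smul, hn]) hv
  rw [inner_smul_left, inner_self_eq_norm_sq_to_K, norm_mul] at this
  simp only [map_inv₀, Complex.conj_ofReal, norm_inv, Complex.norm_real, norm_norm,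
    Complex.coe_algebraMap, norm_pow] at this
  rwa [pow_two, inv_mul_cancel_left₀ hn] at this

/-! ### Parseval -/

section Parseval

variable {ι E : Type*} [NormedAddCommGroup E] [InnerProductSpace ℂ E]

theorem HilbertBasis.hasSum_norm_inner_sq (b : HilbertBasis ι ℂ E) (x : E) :
    HasSum (fun i => ‖inner ℂ (b i) x‖ ^ 2) (‖x‖ ^ 2) := by
  have h := Complex.hasSum_re (b.hasSum_inner_mul_inner x x)
  have h2 : (inner ℂ x x).re = ‖x‖ ^ 2 := inner_self_eq_norm_sq (𝕜 := ℂ) _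
  rw [h2] at h
  refine h.congr_fun fun i => ?_
  rw [← inner_conj_symm, RCLike.norm_conj, Complex.mul_conj, Complex.normSq_eq_norm_sq,
    Complex.ofReal_re]

theorem HilbertBasis.tsum_enorm_inner_sq (b : HilbertBasis ι ℂ E) (x : E) :
    ∑' i, ‖inner ℂ (b i) x‖ₑ ^ 2 = ‖x‖ₑ ^ 2 := by
  have h := b.hasSum_norm_inner_sq x
  simp only [← ofReal_norm, ← ENNReal.ofReal_pow (norm_nonneg _)]
  rw [← ENNReal.ofReal_tsum_of_nonneg (fun _ => by positivity) h.summable, h.tsum_eq]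

end Parseval

/-! ### Hilbert-Schmidt operators: rank-one operators, adjoints, two-sided multiplication. -/

namespace HilbertSchmidt

variable {K : Type*} [NormedAddCommGroup K] [InnerProductSpace ℂ K] [CompleteSpace K]
  {H : Type*} [NormedAddCommGroup H] [InnerProductSpace ℂ H]

/-- A bounded operator which is Hilbert-Schmidt, as an element of the Hilbert space. -/
def ofCLM (T : K →L[ℂ] H) (hT : IsHilbertSchmidt T) : HilbertSchmidt K H := ⟨T, hT⟩

@[simp] theorem toCLM_ofCLM (T : K →L[ℂ] H) (hT : IsHilbertSchmidt T) :
    toCLM (ofCLM T hT) = T := rfl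

theorem hasSum_norm_sq (T : HilbertSchmidt K H) :
    HasSum (fun i => ‖toCLM T (stdBasis K i)‖ ^ 2) (‖T‖ ^ 2) := by
  have h := lp.hasSum_norm (p := 2) (by norm_num) (columns T)
  rw [norm_columns] at h
  simpa [columns_apply] using h

theorem hasSum_inner (S T : HilbertSchmidt K H) :
    HasSum (fun i => inner ℂ (toCLM S (stdBasis K i)) (toCLM T (stdBasis K i)))
      (inner ℂ S T) :=
  lp.hasSum_inner (columns S) (columns T)

theorem isHilbertSchmidt_rankOne (x : H) (y : K) :
    IsHilbertSchmidt (InnerProductSpace.rankOne ℂ x y) := by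
  have h := ((stdBasis K).hasSum_norm_inner_sq y).summable.mul_right (‖x‖ ^ 2)
  refine h.congr fun i => ?_
  rw [InnerProductSpace.rankOne_apply, norm_smul, mul_pow, norm_inner_symm]

/-- The rank-one operator `z ↦ ⟪y, z⟫ x`, as a Hilbert-Schmidt operator. -/
def rankOne (x : H) (y : K) : HilbertSchmidt K H :=
  ofCLM (InnerProductSpace.rankOne ℂ x y) (isHilbertSchmidt_rankOne x y)

@[simp] theorem toCLM_rankOne (x : H) (y : K) :
    toCLM (rankOne x y) = InnerProductSpace.rankOne ℂ x y := rfl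

theorem rankOne_add_left (x x' : H) (y : K) :
    rankOne (x + x') y = rankOne x y + rankOne x' y :=
  toCLM_injective (by simp)

theorem rankOne_add_right (x : H) (y y' : K) :
    rankOne x (y + y') = rankOne x y + rankOne x y' :=
  toCLM_injective (by simp)

theorem rankOne_smul_left (c : ℂ) (x : H) (y : K) :
    rankOne (c • x) y = c • rankOne x y :=
  toCLM_injective (by simp)

theorem rankOne_smul_right (c : ℂ) (x : H) (y : K) :
    rankOne x (c • y) = starRingEnd ℂ c • rankOne x y :=
  toCLM_injective (by simp)

/-- Expanding `y` in the fixed basis collapses the defining series. Matrix coefficients thus become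
Hilbert-Schmidt inner products, and later arguments on rank-one operators do not see the basis. -/
theorem inner_rankOne_left (x : H) (y : K) (T : HilbertSchmidt K H) :
    inner ℂ (rankOne x y) T = inner ℂ x (toCLM T y) := by
  have h1 := hasSum_inner (rankOne x y) T
  have h2 : HasSum (fun i => inner ℂ x (toCLM T ((stdBasis K).repr y i • stdBasis K i)))
      (inner ℂ x (toCLM T y)) :=
    (((stdBasis K).hasSum_repr y).mapL (toCLM T)).mapL (innerSL ℂ x)
  refine h1.unique (h2.congr_fun fun i => ?_)
  rw [toCLM_rankOne, InnerProductSpace.rankOne_apply, inner_smul_left, map_smul,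
    inner_smul_right, HilbertBasis.repr_apply_apply, inner_conj_symm]

theorem inner_rankOne_rankOne (x x' : H) (y y' : K) :
    inner ℂ (rankOne x y) (rankOne x' y') = inner ℂ x x' * inner ℂ y' y := by
  rw [inner_rankOne_left, toCLM_rankOne, InnerProductSpace.rankOne_apply, inner_smul_right,
    mul_comm]

theorem norm_rankOne (x : H) (y : K) : ‖rankOne x y‖ = ‖x‖ * ‖y‖ := by
  have h : ‖rankOne x y‖ ^ 2 = (‖x‖ * ‖y‖) ^ 2 := by
    have := inner_rankOne_rankOne x x y y
    rw [inner_self_eq_norm_sq_to_K, inner_self_eq_norm_sq_to_K, inner_self_eq_norm_sq_to_K,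
      ← mul_pow] at this
    exact_mod_cast this
  exact (sq_eq_sq₀ (norm_nonneg _) (by positivity)).1 h

theorem isHilbertSchmidt_iff_tsum_enorm (T : K →L[ℂ] H) :
    IsHilbertSchmidt T ↔ ∑' i, ‖T (stdBasis K i)‖ₑ ^ 2 ≠ ⊤ := by
  have h : ∀ i, ‖T (stdBasis K i)‖ₑ ^ 2 = ((‖T (stdBasis K i)‖₊ ^ 2 : NNReal) : ENNReal) :=
    fun i => by rw [ENNReal.coe_pow]; rfl
  simp only [h]
  rw [ENNReal.tsum_coe_ne_top_iff_summable, ← NNReal.summable_coe]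
  rfl

theorem enorm_sq_eq_tsum (T : HilbertSchmidt K H) :
    ‖T‖ₑ ^ 2 = ∑' i, ‖toCLM T (stdBasis K i)‖ₑ ^ 2 := by
  have h := hasSum_norm_sq T
  simp only [← ofReal_norm, ← ENNReal.ofReal_pow (norm_nonneg _)]
  rw [← ENNReal.ofReal_tsum_of_nonneg (fun _ => by positivity) h.summable, h.tsum_eq]

theorem isHilbertSchmidt_comp_left {H' : Type*} [NormedAddCommGroup H'] [InnerProductSpace ℂ H']
    (A : H →L[ℂ] H') {T : K →L[ℂ] H} (hT : IsHilbertSchmidt T) : IsHilbertSchmidt (A ∘L T) := by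
  refine Summable.of_nonneg_of_le (fun i => by positivity) (fun i => ?_) (hT.mul_left (‖A‖ ^ 2))
  rw [← mul_pow]
  gcongr
  exact A.le_opNorm _

theorem norm_comp_left_le {H' : Type*} [NormedAddCommGroup H'] [InnerProductSpace ℂ H']
    (A : H →L[ℂ] H') (T : HilbertSchmidt K H) :
    ‖ofCLM _ (isHilbertSchmidt_comp_left A T.isHilbertSchmidt)‖ ≤ ‖A‖ * ‖T‖ := by
  refine (sq_le_sq₀ (norm_nonneg _) (by positivity)).1 ?_
  rw [mul_pow]
  refine hasSum_le (fun i => ?_) (hasSum_norm_sq _) ((hasSum_norm_sq T).mul_left (‖A‖ ^ 2))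
  rw [← mul_pow]
  gcongr
  exact A.le_opNorm _

variable [CompleteSpace H]

/-- Rank-one operators span a dense subspace of the Hilbert-Schmidt operators. -/
theorem dense_span_rankOne :
    Dense (Submodule.span ℂ (Set.range fun p : H × K => rankOne p.1 p.2) :
      Set (HilbertSchmidt K H)) := by
  rw [Submodule.dense_iff_topologicalClosure_eq_top, Submodule.topologicalClosure_eq_top_iff,
    Submodule.eq_bot_iff]
  intro T hT
  refine toCLM_injective ?_
  ext y
  rw [map_zero, zero_apply]
  refine ext_inner_left ℂ fun x => ?_
  rw [← inner_rankOne_left, inner_zero_right]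
  exact (Submodule.mem_orthogonal _ _).1 hT _ (Submodule.subset_span ⟨(x, y), rfl⟩)

/-- A closed linear property of Hilbert-Schmidt operators holds if it holds for those of
rank one. -/
theorem rankOne_induction {p : HilbertSchmidt K H → Prop} (hc : IsClosed {T | p T})
    (h0 : p 0) (hadd : ∀ S T, p S → p T → p (S + T)) (hsmul : ∀ (c : ℂ) T, p T → p (c • T))
    (h : ∀ x y, p (rankOne x y)) (T : HilbertSchmidt K H) : p T := by
  refine dense_span_rankOne.induction (P := p) (fun S hS => ?_) hc T
  induction hS using Submodule.span_induction with
  | mem S hS =>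
    obtain ⟨q, rfl⟩ := hS
    exact h _ _
  | zero => exact h0
  | add S T _ _ hS hT => exact hadd _ _ hS hT
  | smul c S _ hS => exact hsmul _ _ hS

theorem clm_ext_rankOne {G : Type*} [NormedAddCommGroup G] [NormedSpace ℂ G]
    {P Q : HilbertSchmidt K H →L[ℂ] G} (h : ∀ x y, P (rankOne x y) = Q (rankOne x y)) :
    P = Q := by
  ext T
  refine rankOne_induction (p := fun T => P T = Q T) (isClosed_eq P.continuous Q.continuous)
    (by simp) (fun S T hS hT => ?_) (fun c T hT => ?_) h T
  · rw [map_add, map_add, hS, hT]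
  · rw [map_smul, map_smul, hT]

/-- A bounded operator on the Hilbert-Schmidt operators is determined by its quadratic form on
rank-one operators. -/
theorem clm_ext_inner_rankOne {P Q : HilbertSchmidt K H →L[ℂ] HilbertSchmidt K H}
    (h : ∀ x y, inner ℂ (rankOne x y) (P (rankOne x y)) =
      inner ℂ (rankOne x y) (Q (rankOne x y))) : P = Q := by
  have h1 : ∀ (x x' : H) (y : K), inner ℂ (rankOne x y) ((P - Q) (rankOne x' y)) = 0 := by
    intro x x' y
    refine sesquilinear_eq_zero_of_diag
      (fun x x' => inner ℂ (rankOne x y) ((P - Q) (rankOne x' y))) ?_ ?_ ?_ ?_ ?_ x x'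
    · intro u u' v
      simp only [rankOne_add_left, inner_add_left]
    · intro u u' v
      simp only [rankOne_add_left, map_add, inner_add_right]
    · intro c u v
      simp only [rankOne_smul_left, inner_smul_left]
    · intro c u v
      simp only [rankOne_smul_left, map_smul, inner_smul_right]
    · intro v
      simp only [sub_apply, inner_sub_right, h, sub_self]
  have h2 : ∀ (x x' : H) (y y' : K), inner ℂ (rankOne x y') ((P - Q) (rankOne x' y)) = 0 := by
    intro x x' y y'
    refine sesquilinear_eq_zero_of_diag
      (fun y y' => inner ℂ (rankOne x y') ((P - Q) (rankOne x' y))) ?_ ?_ ?_ ?_ ?_ y y'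
    · intro u u' v
      simp only [rankOne_add_right, map_add, inner_add_right]
    · intro u u' v
      simp only [rankOne_add_right, inner_add_left]
    · intro c u v
      simp only [rankOne_smul_right, map_smul, inner_smul_right]
    · intro c u v
      simp only [rankOne_smul_right, inner_smul_left, Complex.conj_conj]
    · intro v
      exact h1 _ _ _
  refine clm_ext_rankOne fun x y => ?_
  rw [← sub_eq_zero, ← sub_apply]
  refine toCLM_injective ?_
  ext z
  rw [map_zero, zero_apply]
  refine ext_inner_left ℂ fun u => ?_
  rw [← inner_rankOne_left, inner_zero_right]
  exact h2 _ _ _ _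

/-- By Parseval both sides equal the double sum of `|⟪f_j, T e_i⟫|²`. In `[0, ∞]` the order of
summation is irrelevant, so no summability is assumed. -/
theorem tsum_enorm_adjoint_sq (T : K →L[ℂ] H) :
    ∑' j, ‖ContinuousLinearMap.adjoint T (stdBasis H j)‖ₑ ^ 2 =
      ∑' i, ‖T (stdBasis K i)‖ₑ ^ 2 := by
  have h1 : ∀ j, ‖ContinuousLinearMap.adjoint T (stdBasis H j)‖ₑ ^ 2 =
      ∑' i, ‖inner ℂ (stdBasis H j) (T (stdBasis K i))‖ₑ ^ 2 := by
    intro j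
    rw [← (stdBasis K).tsum_enorm_inner_sq]
    refine tsum_congr fun i => ?_
    rw [ContinuousLinearMap.adjoint_inner_right, ← ofReal_norm, ← ofReal_norm, norm_inner_symm]
  simp only [h1]
  rw [ENNReal.tsum_comm]
  exact tsum_congr fun i => (stdBasis H).tsum_enorm_inner_sq _

theorem isHilbertSchmidt_adjoint {T : K →L[ℂ] H} (hT : IsHilbertSchmidt T) :
    IsHilbertSchmidt (ContinuousLinearMap.adjoint T) := by
  rw [isHilbertSchmidt_iff_tsum_enorm] at hT ⊢
  rwa [tsum_enorm_adjoint_sq]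

theorem norm_ofCLM_adjoint (T : HilbertSchmidt K H) :
    ‖ofCLM _ (isHilbertSchmidt_adjoint T.isHilbertSchmidt)‖ = ‖T‖ := by
  have h : ‖ofCLM _ (isHilbertSchmidt_adjoint T.isHilbertSchmidt)‖ₑ ^ 2 = ‖T‖ₑ ^ 2 := by
    rw [enorm_sq_eq_tsum, enorm_sq_eq_tsum, toCLM_ofCLM, tsum_enorm_adjoint_sq]
  have h2 := (ENNReal.pow_right_strictMono two_ne_zero).injective h
  rw [← toReal_enorm, h2, toReal_enorm]

theorem isHilbertSchmidt_comp_right {T : K →L[ℂ] H} (hT : IsHilbertSchmidt T) (B : K →L[ℂ] K) :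
    IsHilbertSchmidt (T ∘L B) := by
  have := isHilbertSchmidt_adjoint (isHilbertSchmidt_comp_left (ContinuousLinearMap.adjoint B)
    (isHilbertSchmidt_adjoint hT))
  rwa [ContinuousLinearMap.adjoint_comp, ContinuousLinearMap.adjoint_adjoint,
    ContinuousLinearMap.adjoint_adjoint] at this

theorem norm_comp_right_le (T : HilbertSchmidt K H) (B : K →L[ℂ] K) :
    ‖ofCLM _ (isHilbertSchmidt_comp_right T.isHilbertSchmidt B)‖ ≤ ‖B‖ * ‖T‖ := by
  rw [← norm_ofCLM_adjoint, ← norm_ofCLM_adjoint T,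
    ← LinearIsometryEquiv.norm_map ContinuousLinearMap.adjoint B]
  convert norm_comp_left_le (ContinuousLinearMap.adjoint B)
    (ofCLM _ (isHilbertSchmidt_adjoint T.isHilbertSchmidt)) using 2
  refine toCLM_injective ?_
  simp only [toCLM_ofCLM, ContinuousLinearMap.adjoint_comp]

/-- The bounded operator `T ↦ A T B` on the Hilbert-Schmidt operators. -/
def sandwich (A : H →L[ℂ] H) (B : K →L[ℂ] K) : HilbertSchmidt K H →L[ℂ] HilbertSchmidt K H :=
  LinearMap.mkContinuous
    { toFun := fun T => ofCLM (A ∘L toCLM T ∘L B)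
        (isHilbertSchmidt_comp_left A (isHilbertSchmidt_comp_right T.isHilbertSchmidt B))
      map_add' := fun S T => toCLM_injective (by ext; simp)
      map_smul' := fun c T => toCLM_injective (by ext; simp) }
    (‖A‖ * ‖B‖) (fun T => by
      refine (norm_comp_left_le A
        (ofCLM _ (isHilbertSchmidt_comp_right T.isHilbertSchmidt B))).trans ?_
      rw [mul_assoc]
      gcongr
      exact norm_comp_right_le T B)

@[simp] theorem toCLM_sandwich (A : H →L[ℂ] H) (B : K →L[ℂ] K) (T : HilbertSchmidt K H) :
    toCLM (sandwich A B T) = A ∘L toCLM T ∘L B := rfl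

theorem sandwich_rankOne (A : H →L[ℂ] H) (B : K →L[ℂ] K) (x : H) (y : K) :
    sandwich A B (rankOne x y) = rankOne (A x) (ContinuousLinearMap.adjoint B y) := by
  refine toCLM_injective ?_
  ext z
  simp [ContinuousLinearMap.adjoint_inner_left]

theorem sandwich_mul (A A' : H →L[ℂ] H) (B B' : K →L[ℂ] K) :
    sandwich A B * sandwich A' B' = sandwich (A * A') (B' * B) := rfl

theorem sandwich_one : sandwich (1 : H →L[ℂ] H) (1 : K →L[ℂ] K) = 1 := rfl

theorem star_sandwich (A : H →L[ℂ] H) (B : K →L[ℂ] K) :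
    star (sandwich A B) = sandwich (star A) (star B) := by
  refine clm_ext_rankOne fun x y => ?_
  refine toCLM_injective ?_
  ext z
  refine ext_inner_left ℂ fun u => ?_
  rw [← inner_rankOne_left, ← inner_rankOne_left, sandwich_rankOne,
    ContinuousLinearMap.star_eq_adjoint, ContinuousLinearMap.adjoint_inner_right,
    sandwich_rankOne, inner_rankOne_rankOne, inner_rankOne_rankOne,
    ContinuousLinearMap.star_eq_adjoint, ContinuousLinearMap.star_eq_adjoint,
    ContinuousLinearMap.adjoint_adjoint, ContinuousLinearMap.adjoint_inner_right,
    ContinuousLinearMap.adjoint_inner_right]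

end HilbertSchmidt

/-! ### Projection-valued measures: multiplicativity and diagonal measures. -/

/-- Idempotence of `p + q` forces `p q + q p = 0`; for idempotents this gives `p q = 0` when there
is no 2-torsion, which the complex scalars ensure. -/
theorem IsStarProjection.mul_eq_zero_of_add {A : Type*} [Ring A] [StarRing A]
    [Module ℂ A] {p q : A} (hp : IsStarProjection p) (hq : IsStarProjection q)
    (h : IsStarProjection (p + q)) : p * q = 0 :=
  have : IsAddTorsionFree A := .of_isTorsionFree ℂ A
  IsIdempotentElem.mul_eq_zero_of_anticommute hp.isIdempotentElem
    ((hp.isIdempotentElem.add_iff hq.isIdempotentElem).1 h.isIdempotentElem)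

/-- A bounded measurable function is a uniform limit of simple functions. -/
theorem Measurable.exists_simpleFunc_norm_sub_le {X : Type*} [MeasurableSpace X] {f : X → ℂ}
    (hf : Measurable f) {C : ℝ} (hC : ∀ x, ‖f x‖ ≤ C) {ε : ℝ} (hε : 0 < ε) :
    ∃ g : SimpleFunc X ℂ, ∀ x, ‖f x - g x‖ ≤ ε := by
  obtain ⟨t, -, ht, hcov⟩ := (isCompact_closedBall (0 : ℂ) C).finite_cover_balls hε
  let l := ht.toFinset.toList
  let e : ℕ → ℂ := fun n => l.getD n 0
  refine ⟨(SimpleFunc.nearestPt e l.length).comp f hf, fun x => ?_⟩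
  have hx : f x ∈ Metric.closedBall (0 : ℂ) C := by simpa using hC x
  obtain ⟨c, hc, hxc⟩ := Set.mem_iUnion₂.1 (hcov hx)
  obtain ⟨n, hn, rfl⟩ := List.mem_iff_getElem.1 (show c ∈ l by simpa [l] using hc)
  have h1 := SimpleFunc.edist_nearestPt_le e (f x) (k := n) (N := l.length) hn.le
  have h2 : e n = l[n] := by simp [e, hn]
  rw [h2, edist_dist, edist_dist, ENNReal.ofReal_le_ofReal_iff dist_nonneg] at h1
  rw [SimpleFunc.coe_comp, Function.comp_apply, ← dist_eq_norm, dist_comm]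
  refine h1.trans ?_
  rw [dist_comm]
  exact (Metric.mem_ball.1 hxc).le

namespace PVM

variable {X : Type*} [MeasurableSpace X] {H : Type*} [NormedAddCommGroup H]
  [InnerProductSpace ℂ H] [CompleteSpace H] (E : PVM X H)

theorem proj_apply_proj_apply (s : Set X) (v : H) : E.proj s (E.proj s v) = E.proj s v :=
  congrArg (fun A : H →L[ℂ] H => A v) (E.isStarProjection s).isIdempotentElem.eq

theorem adjoint_proj (s : Set X) : ContinuousLinearMap.adjoint (E.proj s) = E.proj s :=
  (E.isStarProjection s).isSelfAdjoint

theorem inner_proj_self (s : Set X) (v : H) :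
    inner ℂ v (E.proj s v) = ((‖E.proj s v‖ ^ 2 : ℝ) : ℂ) := by
  rw [← E.proj_apply_proj_apply, ← ContinuousLinearMap.adjoint_inner_left, E.adjoint_proj,
    inner_self_eq_norm_sq_to_K, E.proj_apply_proj_apply]
  simp

theorem diag_apply (v : H) {s : Set X} (hs : MeasurableSet s) :
    E.diag v s = ENNReal.ofReal (‖E.proj s v‖ ^ 2) := by
  rw [diag, Measure.ofMeasurable_apply s hs, E.inner_proj_self, Complex.ofReal_re]

instance (v : H) : IsFiniteMeasure (E.diag v) :=
  ⟨by rw [E.diag_apply v MeasurableSet.univ]; exact ENNReal.ofReal_lt_top⟩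

theorem diag_real_apply (v : H) {s : Set X} (hs : MeasurableSet s) :
    (E.diag v).real s = ‖E.proj s v‖ ^ 2 := by
  rw [Measure.real, E.diag_apply v hs, ENNReal.toReal_ofReal (by positivity)]

theorem diag_real_univ (v : H) : (E.diag v).real Set.univ = ‖v‖ ^ 2 := by
  rw [E.diag_real_apply v MeasurableSet.univ, E.proj_univ, one_apply_eq_self]

theorem proj_union {s t : Set X} (hs : MeasurableSet s) (ht : MeasurableSet t)
    (hd : Disjoint s t) : E.proj (s ∪ t) = E.proj s + E.proj t := by
  ext v
  let f : ℕ → Set X := fun n => if n = 0 then s else if n = 1 then t else ∅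
  have hf : ∀ i, MeasurableSet (f i) := by
    intro i
    simp only [f]
    split_ifs
    exacts [hs, ht, MeasurableSet.empty]
  have hdf : Pairwise (Function.onFun Disjoint f) := by
    intro i j hij
    simp only [Function.onFun, f]
    split_ifs <;> first | omega | simp [hd.symm]
  have hU : ⋃ i, f i = s ∪ t := by
    ext x
    simp only [Set.mem_iUnion, Set.mem_union]
    constructor
    · rintro ⟨i, hi⟩
      simp only [f] at hi
      split_ifs at hi
      exacts [Or.inl hi, Or.inr hi, hi.elim]
    · rintro (h | h)
      exacts [⟨0, h⟩, ⟨1, h⟩]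
  have h1 := E.hasSum_proj f hf hdf v
  have h2 : HasSum (fun i => E.proj (f i) v) (∑ i ∈ {0, 1}, E.proj (f i) v) := by
    refine hasSum_sum_of_ne_finset_zero fun i hi => ?_
    simp only [Finset.mem_insert, Finset.mem_singleton, not_or] at hi
    simp [f, hi, E.proj_empty]
  rw [← hU, h1.unique h2]
  simp [f]

theorem proj_mul_of_disjoint {s t : Set X} (hs : MeasurableSet s) (ht : MeasurableSet t)
    (hd : Disjoint s t) : E.proj s * E.proj t = 0 :=
  (E.isStarProjection s).mul_eq_zero_of_add (E.isStarProjection t)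
    (E.proj_union hs ht hd ▸ E.isStarProjection _)

/-- Multiplicativity is not an axiom of `PVM`. It follows by splitting both sets along their
intersection, since projections of disjoint sets are orthogonal. -/
theorem proj_mul {s t : Set X} (hs : MeasurableSet s) (ht : MeasurableSet t) :
    E.proj s * E.proj t = E.proj (s ∩ t) := by
  have h1 : E.proj s = E.proj (s ∩ t) + E.proj (s \ t) := by
    rw [← E.proj_union (hs.inter ht) (hs.diff ht) (Set.disjoint_sdiff_inter.symm),
      Set.inter_union_sdiff]
  have h2 : E.proj t = E.proj (s ∩ t) + E.proj (t \ s) := by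
    rw [← E.proj_union (hs.inter ht) (ht.diff hs)
      (Set.inter_comm s t ▸ Set.disjoint_sdiff_inter.symm), Set.inter_comm, Set.inter_union_sdiff]
  rw [h1, h2, add_mul, mul_add, mul_add, (E.isStarProjection _).isIdempotentElem.eq,
    E.proj_mul_of_disjoint (hs.inter ht) (ht.diff hs)
      (Set.inter_comm s t ▸ Set.disjoint_sdiff_inter.symm),
    E.proj_mul_of_disjoint (hs.diff ht) (hs.inter ht) Set.disjoint_sdiff_inter,
    E.proj_mul_of_disjoint (hs.diff ht) (ht.diff hs)
      (Set.disjoint_left.2 fun x hx hx' => hx.2 hx'.1)]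
  simp

/-! ### Integrals of bounded measurable functions -/

variable {E}

theorem integrable_diag {f : X → ℂ} (hf : Measurable f) {C : ℝ} (hC : ∀ x, ‖f x‖ ≤ C) (v : H) :
    Integrable f (E.diag v) :=
  Integrable.of_bound hf.aestronglyMeasurable C (Eventually.of_forall hC)

theorem IsIntegral.unique {f : X → ℂ} {A B : H →L[ℂ] H} (hA : E.IsIntegral f A)
    (hB : E.IsIntegral f B) : A = B := by
  have h := (ext_inner_map (A : H →ₗ[ℂ] H) (B : H →ₗ[ℂ] H)).1 fun v => by
    have := congrArg (starRingEnd ℂ) ((hA v).trans (hB v).symm)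
    rwa [inner_conj_symm, inner_conj_symm] at this
  ext v
  exact LinearMap.congr_fun h v

/-- The defining identity controls only the quadratic form, whence the factor 2 from the numerical
radius. The sharp constant is not needed. -/
theorem IsIntegral.norm_le {f : X → ℂ} {A : H →L[ℂ] H} (hA : E.IsIntegral f A) {C : ℝ}
    (hC0 : 0 ≤ C) (hC : ∀ x, ‖f x‖ ≤ C) : ‖A‖ ≤ 2 * C := by
  refine A.opNorm_le_two_mul_of_norm_inner_self_le hC0 fun v => ?_
  rw [hA v, ← E.diag_real_univ v]
  exact norm_integral_le_of_norm_le_const (Eventually.of_forall hC)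

theorem IsIntegral.sub {f g : X → ℂ} {A B : H →L[ℂ] H} (hA : E.IsIntegral f A)
    (hB : E.IsIntegral g B) (hf : ∀ v, Integrable f (E.diag v))
    (hg : ∀ v, Integrable g (E.diag v)) : E.IsIntegral (fun x => f x - g x) (A - B) := by
  intro v
  rw [integral_sub (hf v) (hg v), ← hA v, ← hB v, sub_apply, inner_sub_right]

theorem IsIntegral.adjoint {f : X → ℂ} {A : H →L[ℂ] H} (hA : E.IsIntegral f A) :
    E.IsIntegral (fun x => starRingEnd ℂ (f x)) (ContinuousLinearMap.adjoint A) := by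
  intro v
  rw [integral_conj, ← hA v, ContinuousLinearMap.adjoint_inner_right, inner_conj_symm]

variable (E) in
theorem isIntegral_simpleFunc (g : SimpleFunc X ℂ) :
    E.IsIntegral g (∑ c ∈ g.range, c • E.proj (g ⁻¹' {c})) := by
  intro v
  rw [SimpleFunc.integral_eq_sum _ (SimpleFunc.integrable_of_isFiniteMeasure g)]
  simp only [sum_apply, smul_apply, inner_sum, inner_smul_right]
  refine Finset.sum_congr rfl fun c _ => ?_
  rw [E.inner_proj_self, E.diag_real_apply v (g.measurableSet_fiber c), Complex.real_smul,
    mul_comm]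

-- The integrals of uniformly approximating simple functions are Cauchy in operator norm by
-- `IsIntegral.norm_le`, and the quadratic-form identity passes to their limit.
variable (E) in
theorem exists_isIntegral {f : X → ℂ} (hf : Measurable f) {C : ℝ} (hC : ∀ x, ‖f x‖ ≤ C) :
    ∃ A, E.IsIntegral f A := by
  choose g hg using fun n : ℕ =>
    hf.exists_simpleFunc_norm_sub_le hC (Nat.one_div_pos_of_nat (α := ℝ) (n := n))
  let A : ℕ → H →L[ℂ] H := fun n => ∑ c ∈ (g n).range, c • E.proj (g n ⁻¹' {c})
  have hA : ∀ n, E.IsIntegral (g n) (A n) := fun n => E.isIntegral_simpleFunc (g n)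
  have hgi : ∀ n v, Integrable (g n) (E.diag v) := fun n v =>
    SimpleFunc.integrable_of_isFiniteMeasure _
  have hlim : Tendsto (fun n : ℕ => 1 / ((n : ℝ) + 1)) atTop (𝓝 0) :=
    tendsto_one_div_add_atTop_nhds_zero_nat
  have hcau : CauchySeq A := by
    refine cauchySeq_of_le_tendsto_0 (fun n => 2 * (1 / ((n : ℝ) + 1) + 1 / ((n : ℝ) + 1)))
      (fun n m N hn hm => ?_) (by simpa using (hlim.add hlim).const_mul 2)
    rw [dist_eq_norm]
    refine ((hA n).sub (hA m) (hgi n) (hgi m)).norm_le (by positivity) fun x => ?_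
    have e : g n x - g m x = (f x - g m x) - (f x - g n x) := by ring
    rw [e]
    exact (norm_sub_le _ _).trans (add_le_add ((hg m x).trans (Nat.one_div_le_one_div hm))
      ((hg n x).trans (Nat.one_div_le_one_div hn)))
  obtain ⟨B, hB⟩ := cauchySeq_tendsto_of_complete hcau
  refine ⟨B, fun v => ?_⟩
  have h1 : Tendsto (fun n => inner ℂ v (A n v)) atTop (𝓝 (inner ℂ v (B v))) :=
    tendsto_const_nhds.inner (((ContinuousLinearMap.apply ℂ H v).continuous.tendsto B).comp hB)
  have h2 : Tendsto (fun n => ∫ x, g n x ∂(E.diag v)) atTop (𝓝 (∫ x, f x ∂(E.diag v))) := by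
    rw [tendsto_iff_norm_sub_tendsto_zero]
    have hlim' : Tendsto (fun n : ℕ => 1 / ((n : ℝ) + 1) * (E.diag v).real Set.univ) atTop
        (𝓝 0) := by
      simpa using hlim.mul_const ((E.diag v).real Set.univ)
    refine squeeze_zero (fun _ => norm_nonneg _) (fun n => ?_) hlim'
    rw [← integral_sub (hgi n v) (integrable_diag hf hC v)]
    exact norm_integral_le_of_norm_le_const (Eventually.of_forall fun x => by
      rw [norm_sub_rev]; exact hg n x)
  refine tendsto_nhds_unique h1 (h2.congr fun n => (hA n v).symm)

variable (E) in
theorem isIntegral_integral {f : X → ℂ} (hf : Measurable f) {C : ℝ} (hC : ∀ x, ‖f x‖ ≤ C) :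
    E.IsIntegral f (E.integral f) :=
  Classical.epsilon_spec (E.exists_isIntegral hf hC)

theorem IsIntegral.integral_eq {f : X → ℂ} {A : H →L[ℂ] H} (hA : E.IsIntegral f A) :
    E.integral f = A :=
  (Classical.epsilon_spec (p := E.IsIntegral f) ⟨A, hA⟩).unique hA

variable (E) in
theorem adjoint_integral {f : X → ℂ} (hf : Measurable f) {C : ℝ} (hC : ∀ x, ‖f x‖ ≤ C) :
    ContinuousLinearMap.adjoint (E.integral f) = E.integral (fun x => starRingEnd ℂ (f x)) :=
  (E.isIntegral_integral hf hC).adjoint.integral_eq.symm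

variable (E) in
theorem norm_integral_le {f : X → ℂ} (hf : Measurable f) {C : ℝ} (hC0 : 0 ≤ C)
    (hC : ∀ x, ‖f x‖ ≤ C) : ‖E.integral f‖ ≤ 2 * C :=
  (E.isIntegral_integral hf hC).norm_le hC0 hC

/-! ### Measurable dependence on a parameter -/

variable {Z : Type*} [MeasurableSpace Z]

-- Weak measurability would not suffice, since `H` may be non-separable. Strong measurability is
-- obtained directly by induction from rectangles, countable additivity giving a sequential limit of
-- partial sums.
variable (E) in
theorem stronglyMeasurable_proj_section {s : Set (X × Z)} (hs : MeasurableSet s) (v : H) :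
    StronglyMeasurable fun z => E.proj ((fun x => (x, z)) ⁻¹' s) v := by
  have hsec : ∀ {t : Set (X × Z)}, MeasurableSet t → ∀ z : Z,
      MeasurableSet ((fun x => (x, z)) ⁻¹' t) := fun ht z => measurable_prodMk_right ht
  induction s, hs using MeasurableSpace.induction_on_inter generateFrom_prod.symm isPiSystem_prod
    with
  | empty =>
    simp only [Set.preimage_empty]
    exact stronglyMeasurable_const
  | basic t ht =>
    obtain ⟨a, ha, b, hb, rfl⟩ := ht
    classical
    have : (fun z => E.proj ((fun x => (x, z)) ⁻¹' a ×ˢ b) v) =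
        b.indicator fun _ => E.proj a v := by
      funext z
      by_cases hz : z ∈ b
      · rw [Set.mk_preimage_prod_left hz, Set.indicator_of_mem hz]
      · rw [Set.mk_preimage_prod_left_eq_empty hz, Set.indicator_of_notMem hz, E.proj_empty,
          zero_apply]
    rw [this]
    exact stronglyMeasurable_const.indicator hb
  | compl t ht ih =>
    have : (fun z => E.proj ((fun x => (x, z)) ⁻¹' tᶜ) v) =
        fun z => v - E.proj ((fun x => (x, z)) ⁻¹' t) v := by
      funext z
      have h := E.proj_union (hsec ht z) (hsec ht.compl z) (disjoint_compl_right)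
      rw [Set.preimage_compl, Set.union_compl_self, E.proj_univ] at h
      have h2 := congrArg (fun A : H →L[ℂ] H => A v) h
      simp only [one_apply_eq_self, add_apply] at h2
      rw [Set.preimage_compl, eq_sub_iff_add_eq', ← h2]
    rw [this]
    exact stronglyMeasurable_const.sub ih
  | iUnion f hd hf ih =>
    refine stronglyMeasurable_of_tendsto atTop
      (f := fun (n : ℕ) z => ∑ i ∈ Finset.range n, E.proj ((fun x => (x, z)) ⁻¹' f i) v)
      (fun n => Finset.stronglyMeasurable_fun_sum _ fun i _ => ih i) ?_
    rw [tendsto_pi_nhds]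
    intro z
    rw [Set.preimage_iUnion]
    exact (E.hasSum_proj _ (fun i => hsec (hf i) z)
      (fun i j hij => (hd hij).preimage _) v).tendsto_sum_nat

variable (E) in
/-- Integrals against a projection-valued measure depend strongly measurably on a parameter. -/
theorem stronglyMeasurable_integral {α : X × Z → ℂ} (hα : Measurable α) {C : ℝ}
    (hC : ∀ p, ‖α p‖ ≤ C) (v : H) :
    StronglyMeasurable fun z => E.integral (fun x => α (x, z)) v := by
  choose g hg using fun n : ℕ =>
    hα.exists_simpleFunc_norm_sub_le hC (Nat.one_div_pos_of_nat (α := ℝ) (n := n))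
  let gz : ℕ → Z → SimpleFunc X ℂ := fun n z => (g n).comp (fun x => (x, z)) measurable_prodMk_right
  have hgz : ∀ n z, E.integral (gz n z) =
      ∑ c ∈ (g n).range, c • E.proj ((fun x => (x, z)) ⁻¹' (g n ⁻¹' {c})) := by
    intro n z
    rw [(E.isIntegral_simpleFunc (gz n z)).integral_eq]
    -- A section may miss some values of `g n`; their fibres are empty and contribute zero. Summing
    -- over the whole range makes the index set independent of `z`.
    refine Finset.sum_subset (SimpleFunc.range_comp_subset_range _ _) fun c _ hc => ?_
    have : gz n z ⁻¹' {c} = ∅ := SimpleFunc.preimage_eq_empty_iff _ _ |>.2 hc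
    rw [this, E.proj_empty, smul_zero]
  refine stronglyMeasurable_of_tendsto atTop
    (f := fun (n : ℕ) z => E.integral (gz n z) v) (fun n => ?_) ?_
  · simp only [hgz, sum_apply, smul_apply]
    exact Finset.stronglyMeasurable_fun_sum _ fun c _ =>
      (E.stronglyMeasurable_proj_section ((g n).measurableSet_fiber c) v).const_smul c
  · rw [tendsto_pi_nhds]
    intro z
    have hlim : Tendsto (fun n : ℕ => 2 * (1 / ((n : ℝ) + 1)) * ‖v‖) atTop (𝓝 0) := by
      simpa using ((tendsto_one_div_add_atTop_nhds_zero_nat (𝕜 := ℝ)).const_mul 2).mul_const ‖v‖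
    rw [tendsto_iff_norm_sub_tendsto_zero]
    refine squeeze_zero (fun _ => norm_nonneg _) (fun n => ?_) hlim
    rw [← sub_apply]
    refine (ContinuousLinearMap.le_opNorm _ _).trans ?_
    gcongr
    have hm : Measurable fun x => α (x, z) := hα.comp measurable_prodMk_right
    rw [norm_sub_rev, (E.isIntegral_simpleFunc (gz n z)).integral_eq]
    exact ((E.isIntegral_integral hm (fun x => hC _)).sub (E.isIntegral_simpleFunc (gz n z))
      (integrable_diag hm (fun x => hC _))
      (fun v => SimpleFunc.integrable_of_isFiniteMeasure _)).norm_le (by positivity)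
      fun x => hg n (x, z)

end PVM

/-! ### Strong limits of contractions -/

namespace HilbertSchmidt

variable {K : Type*} [NormedAddCommGroup K] [InnerProductSpace ℂ K] [CompleteSpace K]
  {H : Type*} [NormedAddCommGroup H] [InnerProductSpace ℂ H] [CompleteSpace H]

/-- A net of contractions on the Hilbert-Schmidt operators converges strongly as soon as it is
Cauchy on rank-one operators. -/
theorem exists_strong_limit {ι : Type*} [Nonempty ι] [SemilatticeSup ι]
    (Q : ι → HilbertSchmidt K H →L[ℂ] HilbertSchmidt K H) (hQ : ∀ i, ‖Q i‖ ≤ 1)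
    (hc : ∀ x y, CauchySeq fun i => Q i (rankOne x y)) :
    ∃ P : HilbertSchmidt K H →L[ℂ] HilbertSchmidt K H,
      ∀ T, Tendsto (fun i => Q i T) atTop (𝓝 (P T)) := by
  have hle : ∀ i T, ‖Q i T‖ ≤ ‖T‖ := fun i T => by
    simpa using (Q i).le_of_opNorm_le (hQ i) T
  have hcau : ∀ T, CauchySeq fun i => Q i T := by
    refine rankOne_induction (p := fun T => CauchySeq fun i => Q i T) ?_ ?_ ?_ ?_ hc
    · refine isClosed_of_closure_subset fun T hT => ?_
      rw [Set.mem_ofPred_eq, Metric.cauchySeq_iff]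
      intro ε hε
      obtain ⟨S, hS, hTS⟩ := Metric.mem_closure_iff.1 hT (ε / 3) (by positivity)
      obtain ⟨N, hN⟩ := Metric.cauchySeq_iff.1 hS (ε / 3) (by positivity)
      refine ⟨N, fun m hm n hn => ?_⟩
      have h1 : ∀ i, dist (Q i T) (Q i S) < ε / 3 := fun i => by
        rw [dist_eq_norm, ← map_sub]
        exact (hle i _).trans_lt (by rwa [← dist_eq_norm])
      have h2 := hN m hm n hn
      have h3 := h1 n
      rw [dist_comm] at h3
      linarith [dist_triangle4 (Q m T) (Q m S) (Q n S) (Q n T), h1 m]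
    · simpa using cauchySeq_const _
    · intro S T hS hT
      simp only [map_add]
      exact hS.add hT
    · intro c T hT
      simp only [map_smul]
      exact (uniformContinuous_const_smul c).comp_cauchySeq hT
  choose f hf using fun T => cauchySeq_tendsto_of_complete (hcau T)
  refine ⟨(linearMapOfTendsto f (fun i => (Q i : HilbertSchmidt K H →ₗ[ℂ] HilbertSchmidt K H))
    (tendsto_pi_nhds.2 hf)).mkContinuous 1 fun T => ?_, hf⟩
  rw [one_mul]
  exact le_of_tendsto (hf T).norm (Eventually.of_forall fun i => hle i T)

end HilbertSchmidt

/-- A strong limit of orthogonal projections is an orthogonal projection. -/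
theorem IsStarProjection.of_tendsto {V ι : Type*} [NormedAddCommGroup V] [InnerProductSpace ℂ V]
    [CompleteSpace V] {l : Filter ι} [l.NeBot] {Q : ι → V →L[ℂ] V} {P : V →L[ℂ] V}
    (hQ : ∀ i, IsStarProjection (Q i)) (h : ∀ v, Tendsto (fun i => Q i v) l (𝓝 (P v))) :
    IsStarProjection P where
  isIdempotentElem := by
    ext v
    have h1 : Tendsto (fun i => Q i (P v - Q i v)) l (𝓝 0) := by
      have h2 : Tendsto (fun i => P v - Q i v) l (𝓝 0) := by
        simpa using (h v).const_sub (P v)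
      refine squeeze_zero_norm (fun i => ?_) (tendsto_zero_iff_norm_tendsto_zero.1 h2)
      simpa using (Q i).le_of_opNorm_le (hQ i).norm_le (P v - Q i v)
    refine tendsto_nhds_unique (h (P v)) ?_
    have h3 := h1.add (h v)
    rw [zero_add] at h3
    refine h3.congr fun i => ?_
    have h4 : Q i (Q i v) = Q i v :=
      congrArg (fun A : V →L[ℂ] V => A v) (hQ i).isIdempotentElem.eq
    rw [map_sub, h4, sub_add_cancel]
  isSelfAdjoint := by
    rw [ContinuousLinearMap.isSelfAdjoint_iff_isSymmetric]
    intro u v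
    have h1 : Tendsto (fun i => inner ℂ (Q i u) v) l (𝓝 (inner ℂ (P u) v)) :=
      (h u).inner tendsto_const_nhds
    have h2 : Tendsto (fun i => inner ℂ u (Q i v)) l (𝓝 (inner ℂ u (P v))) :=
      tendsto_const_nhds.inner (h v)
    exact tendsto_nhds_unique h1 (h2.congr fun i => ((hQ i).isSelfAdjoint.isSymmetric u v).symm)

theorem MeasureTheory.Measure.le_finsetSum {ι X : Type*} [MeasurableSpace X] (μ : ι → Measure X)
    {s : Finset ι} {i : ι} (hi : i ∈ s) : μ i ≤ ∑ j ∈ s, μ j := by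
  refine Measure.le_iff'.2 fun t => ?_
  rw [Measure.finsetSum_apply]
  exact Finset.single_le_sum_of_canonicallyOrdered (f := fun j => μ j t) hi

/-! ### Existence of the double projection-valued measure -/

namespace PVM

open HilbertSchmidt

open scoped symmDiff

variable {X Y : Type*} [MeasurableSpace X] [MeasurableSpace Y]
  {H K : Type*} [NormedAddCommGroup H] [InnerProductSpace ℂ H] [CompleteSpace H]
  [NormedAddCommGroup K] [InnerProductSpace ℂ K] [CompleteSpace K]
  (E : PVM X H) (F : PVM Y K)

/-- Step functions on rectangles, each paired with the operator which is its integral. -/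
def stepPairs : Submodule ℂ ((X × Y → ℂ) × (HilbertSchmidt K H →L[ℂ] HilbertSchmidt K H)) :=
  Submodule.span ℂ {p | ∃ (Γ : Set X) (Δ : Set Y), MeasurableSet Γ ∧ MeasurableSet Δ ∧
    p = ((Γ ×ˢ Δ).indicator 1, sandwich (E.proj Γ) (F.proj Δ))}

variable {E F}

theorem indicator_mem_stepPairs {Γ : Set X} {Δ : Set Y} (hΓ : MeasurableSet Γ)
    (hΔ : MeasurableSet Δ) :
    ((Γ ×ˢ Δ).indicator 1, sandwich (E.proj Γ) (F.proj Δ)) ∈ stepPairs E F :=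
  Submodule.subset_span ⟨Γ, Δ, hΓ, hΔ, rfl⟩

theorem one_mem_stepPairs : 1 ∈ stepPairs E F := by
  have h := indicator_mem_stepPairs (E := E) (F := F) MeasurableSet.univ MeasurableSet.univ
  rw [E.proj_univ, F.proj_univ, sandwich_one, Set.univ_prod_univ, Set.indicator_univ] at h
  exact h

/-- Intersections of rectangles are rectangles, and `sandwich` is multiplicative with the right-hand
factors reversed; the latter commute here because they are projections of `F`. -/
theorem mul_mem_stepPairs {p q : (X × Y → ℂ) × (HilbertSchmidt K H →L[ℂ] HilbertSchmidt K H)}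
    (hp : p ∈ stepPairs E F) (hq : q ∈ stepPairs E F) : p * q ∈ stepPairs E F := by
  induction hp, hq using Submodule.span_induction₂ with
  | mem_mem p q hp hq =>
    obtain ⟨Γ, Δ, hΓ, hΔ, rfl⟩ := hp
    obtain ⟨Γ', Δ', hΓ', hΔ', rfl⟩ := hq
    refine Submodule.subset_span ⟨Γ ∩ Γ', Δ ∩ Δ', hΓ.inter hΓ', hΔ.inter hΔ', Prod.ext ?_ ?_⟩
    · rw [← Set.prod_inter_prod, Set.inter_indicator_one]
      rfl
    · change sandwich _ _ * sandwich _ _ = _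
      rw [sandwich_mul, E.proj_mul hΓ hΓ', F.proj_mul hΔ' hΔ, Set.inter_comm Δ']
  | zero_left q hq =>
    rw [zero_mul]
    exact zero_mem _
  | zero_right p hp =>
    rw [mul_zero]
    exact zero_mem _
  | add_left p p' q _ _ _ h h' =>
    rw [add_mul]
    exact add_mem h h'
  | add_right p q q' _ _ _ h h' =>
    rw [mul_add]
    exact add_mem h h'
  | smul_left c p q _ _ h =>
    rw [smul_mul_assoc]
    exact Submodule.smul_mem _ _ h
  | smul_right c p q _ _ h =>
    rw [mul_smul_comm]
    exact Submodule.smul_mem _ _ h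

theorem star_mem_stepPairs {p : (X × Y → ℂ) × (HilbertSchmidt K H →L[ℂ] HilbertSchmidt K H)}
    (hp : p ∈ stepPairs E F) : star p ∈ stepPairs E F := by
  classical
  induction hp using Submodule.span_induction with
  | mem p hp =>
    obtain ⟨Γ, Δ, hΓ, hΔ, rfl⟩ := hp
    refine Submodule.subset_span ⟨Γ, Δ, hΓ, hΔ, Prod.ext ?_ ?_⟩
    · funext z
      simp only [Prod.star_def, Pi.star_apply, Set.indicator_apply, Pi.one_apply]
      split_ifs <;> simp
    · simp only [Prod.star_def]
      rw [star_sandwich, (E.isStarProjection Γ).isSelfAdjoint.star_eq,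
        (F.isStarProjection Δ).isSelfAdjoint.star_eq]
  | zero => simp
  | add p q _ _ hp hq => simpa using add_mem hp hq
  | smul c p _ hp => simpa using Submodule.smul_mem _ _ hp

theorem inner_rankOne_sandwich_rankOne {Γ : Set X} {Δ : Set Y} (hΓ : MeasurableSet Γ)
    (hΔ : MeasurableSet Δ) (x : H) (y : K) :
    inner ℂ (rankOne x y) (sandwich (E.proj Γ) (F.proj Δ) (rankOne x y)) =
      (((E.diag x).prod (F.diag y)).real (Γ ×ˢ Δ) : ℂ) := by
  rw [sandwich_rankOne, inner_rankOne_rankOne, F.adjoint_proj, E.inner_proj_self,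
    ← inner_conj_symm, F.inner_proj_self, measureReal_prod_prod, E.diag_real_apply x hΓ,
    F.diag_real_apply y hΔ]
  simp

theorem integral_of_mem_stepPairs
    {p : (X × Y → ℂ) × (HilbertSchmidt K H →L[ℂ] HilbertSchmidt K H)}
    (hp : p ∈ stepPairs E F) : Measurable p.1 ∧ (∃ C : ℝ, ∀ z, ‖p.1 z‖ ≤ C) ∧
      ∀ x y, inner ℂ (rankOne x y) (p.2 (rankOne x y)) =
        ∫ z, p.1 z ∂((E.diag x).prod (F.diag y)) := by
  classical
  induction hp using Submodule.span_induction with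
  | mem p hp =>
    obtain ⟨Γ, Δ, hΓ, hΔ, rfl⟩ := hp
    refine ⟨measurable_one.indicator (hΓ.prod hΔ), ⟨1, fun z => ?_⟩, fun x y => ?_⟩
    · simp only [Set.indicator_apply, Pi.one_apply]
      split_ifs <;> simp
    · rw [inner_rankOne_sandwich_rankOne hΓ hΔ]
      simp only [Pi.one_def]
      rw [integral_indicator_const _ (hΓ.prod hΔ), Complex.real_smul, mul_one]
  | zero => exact ⟨measurable_const, ⟨0, by simp⟩, by simp⟩
  | add p q _ _ hp hq =>
    obtain ⟨mp, ⟨C, hC⟩, ip⟩ := hp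
    obtain ⟨mq, ⟨D, hD⟩, iq⟩ := hq
    refine ⟨mp.add mq, ⟨C + D, fun z => (norm_add_le _ _).trans (add_le_add (hC z) (hD z))⟩,
      fun x y => ?_⟩
    rw [Prod.snd_add, add_apply, inner_add_right, ip, iq, Prod.fst_add]
    exact (integral_add (Integrable.of_bound mp.aestronglyMeasurable C (Eventually.of_forall hC))
      (Integrable.of_bound mq.aestronglyMeasurable D (Eventually.of_forall hD))).symm
  | smul c p _ hp =>
    obtain ⟨mp, ⟨C, hC⟩, ip⟩ := hp
    refine ⟨mp.const_smul c, ⟨‖c‖ * C, fun z => ?_⟩, fun x y => ?_⟩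
    · rw [Prod.smul_fst, Pi.smul_apply, norm_smul]
      exact mul_le_mul_of_nonneg_left (hC z) (norm_nonneg c)
    · rw [Prod.smul_snd, smul_apply, inner_smul_right, ip, Prod.smul_fst]
      exact (integral_const_mul c _).symm

/-- The squared norm is the quadratic form of `P* P`, and `P* P` is paired with `|f|²` because the
step pairs form a *-algebra. -/
theorem norm_sq_of_mem_stepPairs
    {p : (X × Y → ℂ) × (HilbertSchmidt K H →L[ℂ] HilbertSchmidt K H)}
    (hp : p ∈ stepPairs E F) (x : H) (y : K) : ((‖p.2 (rankOne x y)‖ ^ 2 : ℝ) : ℂ) =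
      ∫ z, star (p.1 z) * p.1 z ∂((E.diag x).prod (F.diag y)) := by
  have h := (integral_of_mem_stepPairs (mul_mem_stepPairs (star_mem_stepPairs hp) hp)).2.2 x y
  have h2 : (star p * p).2 (rankOne x y) =
      ContinuousLinearMap.adjoint p.2 (p.2 (rankOne x y)) := rfl
  rw [h2, ContinuousLinearMap.adjoint_inner_right, inner_self_eq_norm_sq_to_K] at h
  rw [Complex.ofReal_pow]
  exact h

/-- This is the well-definedness of the integral: the operator of a step pair depends only on the
function, not on its presentation by rectangles. Algebraic identities between step functions
therefore transfer to operators. -/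
theorem eq_zero_of_mem_stepPairs {P : HilbertSchmidt K H →L[ℂ] HilbertSchmidt K H}
    (hP : (0, P) ∈ stepPairs E F) : P = 0 := by
  refine clm_ext_rankOne fun x y => ?_
  have h := norm_sq_of_mem_stepPairs hP x y
  simpa using h

theorem isStarProjection_of_mem_stepPairs {A : Set (X × Y)}
    {P : HilbertSchmidt K H →L[ℂ] HilbertSchmidt K H}
    (hP : (A.indicator 1, P) ∈ stepPairs E F) : IsStarProjection P where
  isIdempotentElem := by
    have h := sub_mem (mul_mem_stepPairs hP hP) hP
    rw [Prod.mk_mul_mk, Prod.mk_sub_mk, ← Set.inter_indicator_one, Set.inter_self, sub_self] at h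
    exact sub_eq_zero.1 (eq_zero_of_mem_stepPairs h)
  isSelfAdjoint := by
    have h := sub_mem (star_mem_stepPairs hP) hP
    have h1 : star (A.indicator 1 : X × Y → ℂ) = A.indicator 1 := by
      classical
      funext z
      simp only [Pi.star_apply, Set.indicator_apply, Pi.one_apply]
      split_ifs <;> simp
    rw [Prod.star_def, Prod.mk_sub_mk, h1, sub_self] at h
    exact sub_eq_zero.1 (eq_zero_of_mem_stepPairs h)

theorem measurableSet_of_mem_stepPairs {A : Set (X × Y)}
    {P : HilbertSchmidt K H →L[ℂ] HilbertSchmidt K H}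
    (hP : (A.indicator 1, P) ∈ stepPairs E F) : MeasurableSet A := by
  have h := (integral_of_mem_stepPairs hP).1
  exact (measurable_indicator_const_iff (1 : ℂ)).1 h

/-- `|1_A - 1_B|²` is the indicator of `A ∆ B`. Convergence of sets in product measure thus becomes
norm convergence on rank-one operators. -/
theorem norm_sub_sq_of_mem_stepPairs {A B : Set (X × Y)}
    {P Q : HilbertSchmidt K H →L[ℂ] HilbertSchmidt K H}
    (hP : (A.indicator 1, P) ∈ stepPairs E F) (hQ : (B.indicator 1, Q) ∈ stepPairs E F)
    (x : H) (y : K) :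
    ‖P (rankOne x y) - Q (rankOne x y)‖ ^ 2 = ((E.diag x).prod (F.diag y)).real (A ∆ B) := by
  have h := norm_sq_of_mem_stepPairs (sub_mem hP hQ) x y
  have h1 : (fun z => star ((A.indicator 1 - B.indicator 1 : X × Y → ℂ) z) *
      (A.indicator 1 - B.indicator 1 : X × Y → ℂ) z) = (A ∆ B).indicator fun _ => 1 := by
    funext z
    by_cases hA : z ∈ A <;> by_cases hB : z ∈ B <;> simp [hA, hB, Set.mem_symmDiff]
  rw [Prod.mk_sub_mk, h1, integral_indicator_const _ ((measurableSet_of_mem_stepPairs hP).symmDiff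
    (measurableSet_of_mem_stepPairs hQ)), Complex.real_smul, mul_one] at h
  exact_mod_cast h

variable (E F)

/-- The sets whose indicators are step functions on rectangles. -/
def stepSets : Set (Set (X × Y)) := {A | ∃ P, (A.indicator 1, P) ∈ stepPairs E F}

theorem isSetAlgebra_stepSets : IsSetAlgebra (stepSets E F) := by
  have hcompl : ∀ A ∈ stepSets E F, Aᶜ ∈ stepSets E F := by
    rintro A ⟨P, hP⟩
    refine ⟨1 - P, ?_⟩
    rw [Set.indicator_compl]
    exact sub_mem one_mem_stepPairs hP
  refine ⟨⟨0, ?_⟩, hcompl, fun A B hA hB => ?_⟩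
  · rw [Set.indicator_empty]
    exact zero_mem _
  · rw [← compl_compl (A ∪ B), Set.compl_union]
    obtain ⟨P, hP⟩ := hcompl A hA
    obtain ⟨Q, hQ⟩ := hcompl B hB
    refine hcompl _ ⟨P * Q, ?_⟩
    rw [Set.inter_indicator_one]
    exact mul_mem_stepPairs hP hQ

theorem generateFrom_stepSets :
    (inferInstance : MeasurableSpace (X × Y)) = MeasurableSpace.generateFrom (stepSets E F) := by
  refine le_antisymm ?_ (MeasurableSpace.generateFrom_le ?_)
  · rw [← generateFrom_prod]
    refine MeasurableSpace.generateFrom_mono ?_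
    rintro _ ⟨Γ, hΓ, Δ, hΔ, rfl⟩
    exact ⟨_, indicator_mem_stepPairs hΓ hΔ⟩
  · rintro A ⟨P, hP⟩
    exact measurableSet_of_mem_stepPairs hP

/-- Every measurable set of the product carries a projection with the right quadratic form on
rank-one operators. -/
theorem exists_isStarProjection_inner_rankOne {Ω : Set (X × Y)} (hΩ : MeasurableSet Ω) :
    ∃ P : HilbertSchmidt K H →L[ℂ] HilbertSchmidt K H, IsStarProjection P ∧
      ∀ x y, inner ℂ (rankOne x y) (P (rankOne x y)) =
        (((E.diag x).prod (F.diag y)).real Ω : ℂ) := by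
  classical
  -- The index pairs a finite set of vector pairs with an accuracy. A net is used because, without
  -- separability, no single finite measure need control all the measures `E_{x,x} × F_{y,y}`.
  have happ : ∀ i : Finset (H × K) × ℕ, ∃ A Q, (A.indicator 1, Q) ∈ stepPairs E F ∧
      (∑ p ∈ i.1, (E.diag p.1).prod (F.diag p.2)) (Ω ∆ A) <
        ENNReal.ofReal (1 / ((i.2 : ℝ) + 1)) := by
    intro i
    obtain ⟨A, ⟨Q, hQ⟩, h⟩ := (Measure.MeasureDense.of_generateFrom_isSetAlgebra_finite
      (μ := ∑ p ∈ i.1, (E.diag p.1).prod (F.diag p.2)) (isSetAlgebra_stepSets E F)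
      (generateFrom_stepSets E F)).approx Ω hΩ (measure_ne_top _ _) (1 / ((i.2 : ℝ) + 1))
      (by positivity)
    exact ⟨A, Q, hQ, h⟩
  choose A Q hQ hA using happ
  have hQp := fun i => isStarProjection_of_mem_stepPairs (hQ i)
  have hlim : ∀ x y, Tendsto (fun i => ((E.diag x).prod (F.diag y)).real (Ω ∆ A i)) atTop
      (𝓝 0) := by
    intro x y
    rw [Metric.tendsto_atTop]
    intro ε hε
    obtain ⟨N, hN⟩ := exists_nat_one_div_lt hε
    refine ⟨({(x, y)}, N), fun i hi => ?_⟩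
    rw [Real.dist_0_eq_abs, abs_of_nonneg measureReal_nonneg]
    refine lt_of_le_of_lt ?_ hN
    refine le_trans ?_ (Nat.one_div_le_one_div hi.2)
    refine ENNReal.toReal_le_of_le_ofReal (by positivity) (le_trans ?_ (hA i).le)
    exact Measure.le_iff'.1 (Measure.le_finsetSum
      (fun p : H × K => (E.diag p.1).prod (F.diag p.2)) (hi.1 (Finset.mem_singleton_self (x, y)))) _
  have hcau : ∀ x y, CauchySeq fun i => Q i (rankOne x y) := by
    intro x y
    rw [Metric.cauchySeq_iff]
    intro ε hε
    have hε2 : 0 < ε ^ 2 / 2 := by positivity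
    obtain ⟨N, hN⟩ := Metric.tendsto_atTop.1 (hlim x y) _ hε2
    refine ⟨N, fun m hm n hn => ?_⟩
    rw [dist_eq_norm]
    refine (sq_lt_sq₀ (norm_nonneg _) hε.le).1 ?_
    rw [norm_sub_sq_of_mem_stepPairs (hQ m) (hQ n)]
    have h1 := hN m hm
    have h2 := hN n hn
    rw [Real.dist_0_eq_abs, abs_of_nonneg measureReal_nonneg] at h1 h2
    have h3 := measureReal_symmDiff_le (μ := (E.diag x).prod (F.diag y)) (s := A m) (t := Ω) (A n)
    rw [symmDiff_comm (A m) Ω] at h3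
    linarith
  obtain ⟨P, hP⟩ := exists_strong_limit Q (fun i => (hQp i).norm_le) hcau
  refine ⟨P, IsStarProjection.of_tendsto hQp hP, fun x y => ?_⟩
  have h1 : Tendsto (fun i => inner ℂ (rankOne x y) (Q i (rankOne x y))) atTop
      (𝓝 (inner ℂ (rankOne x y) (P (rankOne x y)))) := tendsto_const_nhds.inner (hP _)
  have h2 : ∀ i, inner ℂ (rankOne x y) (Q i (rankOne x y)) =
      (((E.diag x).prod (F.diag y)).real (A i) : ℂ) := by
    intro i
    rw [(integral_of_mem_stepPairs (hQ i)).2.2]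
    simp only [Pi.one_def]
    rw [integral_indicator_const _ (measurableSet_of_mem_stepPairs (hQ i)), Complex.real_smul,
      mul_one]
  refine tendsto_nhds_unique (h1.congr h2) ((Complex.continuous_ofReal.tendsto _).comp ?_)
  rw [tendsto_iff_norm_sub_tendsto_zero]
  refine squeeze_zero (fun _ => norm_nonneg _) (fun i => ?_) (hlim x y)
  rw [Real.norm_eq_abs, symmDiff_comm]
  exact abs_measureReal_sub_le_measureReal_symmDiff
    (measurableSet_of_mem_stepPairs (hQ i)).nullMeasurableSet hΩ.nullMeasurableSet

open Classical in
/-- The value on a set of the product projection-valued measure on the Hilbert-Schmidt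
operators. -/
def doubleProj (Ω : Set (X × Y)) : HilbertSchmidt K H →L[ℂ] HilbertSchmidt K H :=
  if hΩ : MeasurableSet Ω then (exists_isStarProjection_inner_rankOne E F hΩ).choose else 0

theorem isStarProjection_doubleProj (Ω : Set (X × Y)) : IsStarProjection (doubleProj E F Ω) := by
  rw [doubleProj]
  split_ifs with h
  · exact (exists_isStarProjection_inner_rankOne E F h).choose_spec.1
  · exact IsStarProjection.zero _

variable {E F}

theorem inner_doubleProj {Ω : Set (X × Y)} (hΩ : MeasurableSet Ω) (x : H) (y : K) :
    inner ℂ (rankOne x y) (doubleProj E F Ω (rankOne x y)) =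
      (((E.diag x).prod (F.diag y)).real Ω : ℂ) := by
  rw [doubleProj, dif_pos hΩ]
  exact (exists_isStarProjection_inner_rankOne E F hΩ).choose_spec.2 x y

theorem norm_doubleProj_rankOne_sq {Ω : Set (X × Y)} (hΩ : MeasurableSet Ω) (x : H) (y : K) :
    ‖doubleProj E F Ω (rankOne x y)‖ ^ 2 = ((E.diag x).prod (F.diag y)).real Ω := by
  have h := inner_doubleProj (E := E) (F := F) hΩ x y
  have hp := isStarProjection_doubleProj E F Ω
  have h1 : doubleProj E F Ω (doubleProj E F Ω (rankOne x y)) = doubleProj E F Ω (rankOne x y) :=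
    congrArg (fun A : HilbertSchmidt K H →L[ℂ] HilbertSchmidt K H => A (rankOne x y))
      hp.isIdempotentElem.eq
  rw [← h1] at h
  have h2 := hp.isSelfAdjoint.isSymmetric (rankOne x y) (doubleProj E F Ω (rankOne x y))
  rw [ContinuousLinearMap.coe_coe] at h2
  rw [← h2, inner_self_eq_norm_sq_to_K] at h
  rw [← Complex.ofReal_inj, Complex.ofReal_pow]
  exact h

theorem doubleProj_prod {Γ : Set X} {Δ : Set Y} (hΓ : MeasurableSet Γ) (hΔ : MeasurableSet Δ) :
    doubleProj E F (Γ ×ˢ Δ) = sandwich (E.proj Γ) (F.proj Δ) :=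
  clm_ext_inner_rankOne fun x y => by
    rw [inner_doubleProj (hΓ.prod hΔ), inner_rankOne_sandwich_rankOne hΓ hΔ]

theorem doubleProj_biUnion {f : ℕ → Set (X × Y)} (hf : ∀ i, MeasurableSet (f i))
    (hd : Pairwise (Function.onFun Disjoint f)) (s : Finset ℕ) :
    doubleProj E F (⋃ i ∈ s, f i) = ∑ i ∈ s, doubleProj E F (f i) :=
  clm_ext_inner_rankOne fun x y => by
    rw [inner_doubleProj (s.measurableSet_biUnion fun i _ => hf i), sum_apply, inner_sum,
      measureReal_biUnion_finset (fun i _ j _ hij => hd hij) fun i _ => hf i, Complex.ofReal_sum]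
    exact Finset.sum_congr rfl fun i _ => (inner_doubleProj (hf i) x y).symm

theorem doubleProj_sub {Ω Ω' : Set (X × Y)} (hΩ : MeasurableSet Ω) (hΩ' : MeasurableSet Ω')
    (h : Ω' ⊆ Ω) : doubleProj E F Ω - doubleProj E F Ω' = doubleProj E F (Ω \ Ω') :=
  clm_ext_inner_rankOne fun x y => by
    rw [inner_doubleProj (hΩ.diff hΩ'), measureReal_sdiff h hΩ', sub_apply, inner_sub_right,
      inner_doubleProj hΩ, inner_doubleProj hΩ', Complex.ofReal_sub]

/-- On a rank-one operator the squared error of a partial sum is the remaining product measure,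
which tends to zero. The partial sums are projections, hence contractions, so convergence extends to
all `T` by density. -/
theorem hasSum_doubleProj {f : ℕ → Set (X × Y)} (hf : ∀ i, MeasurableSet (f i))
    (hd : Pairwise (Function.onFun Disjoint f)) (T : HilbertSchmidt K H) :
    HasSum (fun i => doubleProj E F (f i) T) (doubleProj E F (⋃ i, f i) T) := by
  have hU : MeasurableSet (⋃ i, f i) := MeasurableSet.iUnion hf
  have hs : ∀ s : Finset ℕ, MeasurableSet (⋃ i ∈ s, f i) :=
    fun s => s.measurableSet_biUnion fun i _ => hf i
  have hsub : ∀ s : Finset ℕ, ⋃ i ∈ s, f i ⊆ ⋃ i, f i :=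
    fun s => Set.iUnion₂_subset fun i _ => Set.subset_iUnion f i
  have h1 : ∀ x y, Tendsto (fun s : Finset ℕ => doubleProj E F (⋃ i ∈ s, f i) (rankOne x y)) atTop
      (𝓝 (doubleProj E F (⋃ i, f i) (rankOne x y))) := by
    intro x y
    have h2 : HasSum (fun i => ((E.diag x).prod (F.diag y)).real (f i))
        (((E.diag x).prod (F.diag y)).real (⋃ i, f i)) := by
      have h := ((E.diag x).prod (F.diag y)).toSignedMeasure.m_iUnion hf hd
      simpa only [Measure.toSignedMeasure_apply_measurable (hf _),
        Measure.toSignedMeasure_apply_measurable hU] using h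
    have h3 : ∀ s : Finset ℕ, ‖doubleProj E F (⋃ i ∈ s, f i) (rankOne x y) -
        doubleProj E F (⋃ i, f i) (rankOne x y)‖ ^ 2 =
        ((E.diag x).prod (F.diag y)).real (⋃ i, f i) -
          ∑ i ∈ s, ((E.diag x).prod (F.diag y)).real (f i) := by
      intro s
      rw [norm_sub_rev, ← sub_apply, doubleProj_sub hU (hs s) (hsub s),
        norm_doubleProj_rankOne_sq (hU.diff (hs s)), measureReal_sdiff (hsub s) (hs s),
        measureReal_biUnion_finset (fun i _ j _ hij => hd hij) fun i _ => hf i]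
    rw [tendsto_iff_norm_sub_tendsto_zero]
    have h4 : Tendsto (fun s : Finset ℕ => √(((E.diag x).prod (F.diag y)).real (⋃ i, f i) -
          ∑ i ∈ s, ((E.diag x).prod (F.diag y)).real (f i))) atTop (𝓝 0) := by
      have := (Real.continuous_sqrt.tendsto _).comp (Tendsto.const_sub
        (((E.diag x).prod (F.diag y)).real (⋃ i, f i)) h2)
      rwa [sub_self, Real.sqrt_zero] at this
    refine h4.congr fun s => ?_
    rw [← h3, Real.sqrt_sq (norm_nonneg _)]
  obtain ⟨P, hP⟩ := exists_strong_limit (fun s : Finset ℕ => doubleProj E F (⋃ i ∈ s, f i))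
    (fun s => (isStarProjection_doubleProj E F _).norm_le) fun x y => (h1 x y).cauchySeq
  have hPU : P = doubleProj E F (⋃ i, f i) :=
    clm_ext_rankOne fun x y => tendsto_nhds_unique (hP _) (h1 x y)
  rw [← hPU]
  refine (hP T).congr fun s => ?_
  rw [doubleProj_biUnion hf hd, sum_apply]

theorem exists_isDoublePVM (E : PVM X H) (F : PVM Y K) : ∃ G, IsDoublePVM E F G := by
  refine ⟨⟨doubleProj E F, isStarProjection_doubleProj E F, ?_, fun s hs => dif_neg hs,
    fun f hf hd T => hasSum_doubleProj hf hd T⟩, fun Γ Δ hΓ hΔ T => ?_⟩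
  · rw [← Set.univ_prod_univ, doubleProj_prod MeasurableSet.univ MeasurableSet.univ, E.proj_univ,
      F.proj_univ, sandwich_one]
  · change toCLM (doubleProj E F (Γ ×ˢ Δ) T) = _
    rw [doubleProj_prod hΓ hΔ, toCLM_sandwich]

theorem isDoublePVM_doublePVM [Nonempty X] [Nonempty Y] (E : PVM X H) (F : PVM Y K) :
    IsDoublePVM E F (doublePVM E F) :=
  Classical.epsilon_spec (exists_isDoublePVM E F)

end PVM

/-- On rank-one operators the diagonal measures of the double projection-valued measure are
product measures. -/
theorem IsDoublePVM.diag_rankOne {X Y : Type*} [MeasurableSpace X] [MeasurableSpace Y]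
    {H K : Type*} [NormedAddCommGroup H] [InnerProductSpace ℂ H] [CompleteSpace H]
    [NormedAddCommGroup K] [InnerProductSpace ℂ K] [CompleteSpace K] {E : PVM X H} {F : PVM Y K}
    {G : PVM (X × Y) (HilbertSchmidt K H)} (hG : IsDoublePVM E F G) (x : H) (y : K) :
    G.diag (HilbertSchmidt.rankOne x y) = (E.diag x).prod (F.diag y) := by
  symm
  refine Measure.prod_eq fun Γ Δ hΓ hΔ => ?_
  have h : G.proj (Γ ×ˢ Δ) (HilbertSchmidt.rankOne x y) =
      HilbertSchmidt.sandwich (E.proj Γ) (F.proj Δ) (HilbertSchmidt.rankOne x y) :=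
    HilbertSchmidt.toCLM_injective (hG Γ Δ hΓ hΔ _)
  rw [G.diag_apply _ (hΓ.prod hΔ), h, HilbertSchmidt.sandwich_rankOne, F.adjoint_proj,
    HilbertSchmidt.norm_rankOne, mul_pow, ENNReal.ofReal_mul (by positivity), E.diag_apply x hΓ,
    F.diag_apply y hΔ]

/-! ### Trace-class operators -/

/-- Douglas factorization: an operator dominated by `P` factors through `P` by a contraction. -/
theorem ContinuousLinearMap.exists_eq_comp_of_norm_le {V G H : Type*}
    [NormedAddCommGroup V] [NormedSpace ℂ V] [NormedAddCommGroup G] [InnerProductSpace ℂ G]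
    [CompleteSpace G] [NormedAddCommGroup H] [NormedSpace ℂ H] [CompleteSpace H]
    (T : V →L[ℂ] H) (P : V →L[ℂ] G) (h : ∀ x, ‖T x‖ ≤ ‖P x‖) :
    ∃ U : G →L[ℂ] H, (∀ y, ‖U y‖ ≤ ‖y‖) ∧ ∀ x, T x = U (P x) := by
  let M := (LinearMap.range (P : V →ₗ[ℂ] G)).topologicalClosure
  have : CompleteSpace M := (Submodule.isClosed_topologicalClosure _).completeSpace_coe
  let e : V →ₗ[ℂ] M := (P : V →ₗ[ℂ] G).codRestrict M fun x =>
    Submodule.le_topologicalClosure _ (LinearMap.mem_range_self _ x)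
  have he : DenseRange e := by
    intro y
    rw [Metric.mem_closure_iff]
    intro ε hε
    obtain ⟨_, ⟨x, rfl⟩, hx⟩ := Metric.mem_closure_iff.1
      (show (y : G) ∈ closure (LinearMap.range (P : V →ₗ[ℂ] G) : Set G) from y.2) ε hε
    exact ⟨e x, ⟨x, rfl⟩, hx⟩
  have hb : ∀ x, ‖(T : V →ₗ[ℂ] H) x‖ ≤ 1 * ‖e x‖ := fun x => by
    rw [one_mul]
    exact h x
  -- `U` sends `P x` to `T x`, extends by continuity to the closure of the range, and vanishes on
  -- the orthogonal complement.
  refine ⟨(T : V →ₗ[ℂ] H).extendOfNorm e ∘L M.orthogonalProjectionOnto, fun y => ?_, fun x => ?_⟩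
  · rw [ContinuousLinearMap.comp_apply]
    refine (LinearMap.norm_extendOfNorm_apply_le he 1 hb _).trans ?_
    rw [one_mul]
    exact M.norm_orthogonalProjectionOnto_apply_le y
  · have h1 : M.orthogonalProjectionOnto (P x) = e x :=
      M.orthogonalProjectionOnto_mem_subspace_eq_self (e x)
    rw [ContinuousLinearMap.comp_apply, h1]
    exact (LinearMap.extendOfNorm_eq he ⟨1, hb⟩ x).symm

section TraceClass

variable {K : Type*} [NormedAddCommGroup K] [InnerProductSpace ℂ K] [CompleteSpace K]
  {H : Type*} [NormedAddCommGroup H] [InnerProductSpace ℂ H] [CompleteSpace H]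

theorem isTraceClass_rankOne (x : H) (y : K) :
    IsTraceClass (InnerProductSpace.rankOne ℂ x y) := by
  -- For `y = 0` the quotient `‖x‖ / ‖y‖` is zero by convention, and the formula still holds because
  -- both sides vanish.
  have hsq : CFC.sqrt (ContinuousLinearMap.adjoint (InnerProductSpace.rankOne ℂ x y) ∘L
      InnerProductSpace.rankOne ℂ x y) =
      ((‖x‖ / ‖y‖ : ℝ) : ℂ) • InnerProductSpace.rankOne ℂ y y := by
    refine CFC.sqrt_unique ?_ ?_
    · ext z
      by_cases hy : y = 0
      · simp [hy]
      have hn : (‖y‖ : ℂ) ≠ 0 := by simpa using hy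
      simp only [mul_apply_eq_comp, smul_apply,
        InnerProductSpace.rankOne_apply, map_smul, ContinuousLinearMap.comp_apply,
        InnerProductSpace.adjoint_rankOne, inner_self_eq_norm_sq_to_K, smul_smul,
        Complex.ofReal_div, Complex.coe_algebraMap]
      congr 1
      field_simp
    · rw [ContinuousLinearMap.nonneg_iff_isPositive]
      exact (InnerProductSpace.isPositive_rankOne_self y).smul_of_nonneg
        (Complex.zero_le_real.2 (by positivity))
  rw [IsTraceClass, hsq]
  have h := ((stdBasis K).hasSum_norm_inner_sq y).summable.mul_left (‖x‖ / ‖y‖)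
  refine h.congr fun i => ?_
  rw [smul_apply, InnerProductSpace.rankOne_apply, inner_smul_right, inner_smul_right,
    Complex.re_ofReal_mul, ← inner_conj_symm y, mul_comm (starRingEnd ℂ _), Complex.mul_conj,
    Complex.normSq_eq_norm_sq, Complex.ofReal_re]

namespace HilbertSchmidt

/-- The inclusion of the Hilbert-Schmidt operators into the bounded operators, as a bounded
map. -/
def toCLML : HilbertSchmidt K H →L[ℂ] (K →L[ℂ] H) :=
  toCLM.mkContinuous 1 fun T => by simpa using norm_toCLM_le T

@[simp] theorem toCLML_apply (T : HilbertSchmidt K H) : toCLML T = toCLM T := rfl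

/-- A trace-class operator is an absolutely convergent sum of rank-one operators. -/
theorem exists_hasSum_rankOne_of_isTraceClass {R : HilbertSchmidt K H}
    (hR : IsTraceClass (toCLM R)) : ∃ (x : hilbertIndex K → H) (y : hilbertIndex K → K),
      Summable (fun i => ‖x i‖ * ‖y i‖) ∧ HasSum (fun i => rankOne (x i) (y i)) R := by
  set A := ContinuousLinearMap.adjoint (toCLM R) ∘L toCLM R with hA
  have hA0 : 0 ≤ A := by
    rw [ContinuousLinearMap.nonneg_iff_isPositive]
    exact ContinuousLinearMap.isPositive_adjoint_comp_self _
  set P := CFC.sqrt A with hP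
  have hP0 : 0 ≤ P := CFC.sqrt_nonneg A
  have hPP : P * P = A := CFC.sqrt_mul_sqrt_self A hA0
  have hPsa := (P.nonneg_iff_isPositive.1 hP0).isSelfAdjoint.isSymmetric
  set S := CFC.sqrt P with hS
  have hS0 : 0 ≤ S := CFC.sqrt_nonneg P
  have hSS : S * S = P := CFC.sqrt_mul_sqrt_self P hP0
  have hSsa := (S.nonneg_iff_isPositive.1 hS0).isSelfAdjoint.isSymmetric
  have hnP : ∀ z, ‖toCLM R z‖ ≤ ‖P z‖ := by
    intro z
    have h1 : inner ℂ (P z) (P z) = inner ℂ (toCLM R z) (toCLM R z) := by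
      have h2 : inner ℂ (P z) (P z) = inner ℂ z (P (P z)) := hPsa z (P z)
      have h3 : P (P z) = A z := congrArg (fun B : K →L[ℂ] K => B z) hPP
      rw [h2, h3, hA, ContinuousLinearMap.comp_apply, ContinuousLinearMap.adjoint_inner_right]
    rw [@norm_eq_sqrt_re_inner ℂ, @norm_eq_sqrt_re_inner ℂ _ _ _ _ (P z), h1]
  obtain ⟨U, hU, hRU⟩ := (toCLM R).exists_eq_comp_of_norm_le P hnP
  have hnS : ∀ z, ‖S z‖ ^ 2 = (inner ℂ z (P z)).re := by
    intro z
    have h2 : inner ℂ (S z) (S z) = inner ℂ z (S (S z)) := hSsa z (S z)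
    have h3 : S (S z) = P z := congrArg (fun B : K →L[ℂ] K => B z) hSS
    rw [← h3, ← h2]
    exact (inner_self_eq_norm_sq (𝕜 := ℂ) _).symm
  have hsum : Summable fun i =>
      ‖U (S (stdBasis K i))‖ * ‖S (stdBasis K i)‖ := by
    refine Summable.of_nonneg_of_le (fun i => by positivity) (fun i => ?_) hR
    rw [← hA, ← hP, ← hnS, pow_two]
    gcongr
    exact hU _
  -- With `|R| = S²` and `R = U |R|`, expanding `S z` in the basis gives `R z = ∑ ⟪S eᵢ, z⟫ U S eᵢ`.
  -- The norms are summable since `‖U S eᵢ‖ ‖S eᵢ‖ ≤ ‖S eᵢ‖² = ⟪eᵢ, |R| eᵢ⟫`.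
  refine ⟨fun i => U (S (stdBasis K i)), fun i => S (stdBasis K i), hsum, ?_⟩
  have hsum' : Summable fun i => rankOne (U (S (stdBasis K i))) (S (stdBasis K i)) :=
    Summable.of_norm (by simpa only [norm_rankOne] using hsum)
  obtain ⟨R', hR'⟩ := hsum'
  convert hR'
  refine toCLM_injective ?_
  ext z
  have h1 : HasSum (fun i => inner ℂ (S (stdBasis K i)) z • U (S (stdBasis K i)))
      (toCLM R' z) :=
    (hR'.mapL toCLML).mapL (ContinuousLinearMap.apply ℂ H z)
  have h2 : HasSum (fun i => (U ∘L S) ((stdBasis K).repr (S z) i • stdBasis K i))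
      ((U ∘L S) (S z)) := ((stdBasis K).hasSum_repr (S z)).mapL (U ∘L S)
  have h3 : (U ∘L S) (S z) = toCLM R z := by
    rw [hRU]
    exact congrArg U (congrArg (fun B : K →L[ℂ] K => B z) hSS)
  rw [← h3]
  refine h2.unique (h1.congr_fun fun i => ?_)
  have h4 : inner ℂ (S (stdBasis K i)) z = inner ℂ (stdBasis K i) (S z) :=
    hSsa (stdBasis K i) z
  rw [map_smul, HilbertBasis.repr_apply_apply, h4]
  rfl

end HilbertSchmidt

end TraceClass

/-- Parseval's identity under the integral sign, for an orthonormal basis of any cardinality. -/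
theorem HilbertBasis.hasSum_integral_inner_mul_inner {ι V Z : Type*} [NormedAddCommGroup V]
    [InnerProductSpace ℂ V] [MeasurableSpace Z] (b : HilbertBasis ι ℂ V)
    (ν : Measure Z) [IsFiniteMeasure ν] {f g : Z → V} (hf : StronglyMeasurable f)
    (hg : StronglyMeasurable g) {C D : ℝ} (hC : ∀ z, ‖f z‖ ≤ C) (hD : ∀ z, ‖g z‖ ≤ D) :
    (∀ s : Finset ι, ∑ j ∈ s, ‖∫ z, inner ℂ (f z) (b j) * inner ℂ (b j) (g z) ∂ν‖ ≤
      C * D * ν.real Set.univ) ∧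
    HasSum (fun j => ∫ z, inner ℂ (f z) (b j) * inner ℂ (b j) (g z) ∂ν)
      (∫ z, inner ℂ (f z) (g z) ∂ν) := by
  have hmeas : ∀ j, StronglyMeasurable fun z => inner ℂ (f z) (b j) * inner ℂ (b j) (g z) :=
    fun j => (hf.inner stronglyMeasurable_const).mul (stronglyMeasurable_const.inner hg)
  have hbess : ∀ (s : Finset ι) z,
      ∑ j ∈ s, ‖inner ℂ (f z) (b j) * inner ℂ (b j) (g z)‖ ≤ C * D := by
    intro s z
    have h1 : ∀ v : V, ∑ j ∈ s, ‖inner ℂ (b j) v‖ ^ 2 ≤ ‖v‖ ^ 2 := fun v =>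
      b.orthonormal.sum_inner_products_le v
    calc ∑ j ∈ s, ‖inner ℂ (f z) (b j) * inner ℂ (b j) (g z)‖
        = ∑ j ∈ s, ‖inner ℂ (b j) (f z)‖ * ‖inner ℂ (b j) (g z)‖ := by
          refine Finset.sum_congr rfl fun j _ => ?_
          rw [norm_mul, norm_inner_symm]
      _ ≤ √(∑ j ∈ s, ‖inner ℂ (b j) (f z)‖ ^ 2) * √(∑ j ∈ s, ‖inner ℂ (b j) (g z)‖ ^ 2) :=
          Real.sum_mul_le_sqrt_mul_sqrt _ _ _
      _ ≤ ‖f z‖ * ‖g z‖ := by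
          gcongr
          · exact Real.sqrt_le_iff.2 ⟨norm_nonneg _, h1 _⟩
          · exact Real.sqrt_le_iff.2 ⟨norm_nonneg _, h1 _⟩
      _ ≤ C * D := mul_le_mul (hC z) (hD z) (norm_nonneg _) ((norm_nonneg _).trans (hC z))
  have hterm : ∀ j z, ‖inner ℂ (f z) (b j) * inner ℂ (b j) (g z)‖ ≤ C * D := fun j z => by
    simpa using hbess {j} z
  have hint : ∀ j, Integrable (fun z => inner ℂ (f z) (b j) * inner ℂ (b j) (g z)) ν := fun j =>
    Integrable.of_bound (hmeas j).aestronglyMeasurable (C * D) (Eventually.of_forall (hterm j))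
  have hsum : ∀ s : Finset ι,
      ∑ j ∈ s, ∫ z, ‖inner ℂ (f z) (b j) * inner ℂ (b j) (g z)‖ ∂ν ≤
        C * D * ν.real Set.univ := by
    intro s
    rw [← integral_finsetSum _ fun j _ => (hint j).norm]
    refine (Real.le_norm_self _).trans
      (norm_integral_le_of_norm_le_const (Eventually.of_forall fun z => ?_))
    rw [Real.norm_of_nonneg (Finset.sum_nonneg fun _ _ => norm_nonneg _)]
    exact hbess s z
  refine ⟨fun s => (Finset.sum_le_sum fun j _ => norm_integral_le_integral_norm _).trans (hsum s),
    ?_⟩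
  -- Interchanging sum and integral needs a countable index set. Let `J` collect the basis vectors
  -- not orthogonal to some point of a countable set whose closure contains the range of `f`;
  -- outside `J` every term vanishes identically.
  obtain ⟨t, htc, htd⟩ := hf.isSeparable_range
  let J : Set ι := ⋃ v ∈ t, Function.support fun j => inner ℂ (b j) v
  have hJ : J.Countable := htc.biUnion fun v _ => by
    have h := (b.summable_inner_mul_inner v v).countable_support
    refine h.mono fun j hj => ?_
    simp only [Function.mem_support] at hj ⊢
    exact mul_ne_zero (fun h0 => hj (inner_eq_zero_symm.1 h0)) hj
  have hJ0 : ∀ j ∉ J, ∀ z, inner ℂ (f z) (b j) = 0 := by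
    intro j hj z
    have hcl : IsClosed {v : V | inner ℂ v (b j) = 0} :=
      isClosed_eq (by fun_prop) continuous_const
    refine (hcl.closure_subset_iff.2 fun v hv => ?_) (htd ⟨z, rfl⟩)
    by_contra h0
    exact hj (Set.mem_biUnion hv fun h1 => h0 (inner_eq_zero_symm.1 h1))
  have : Countable J := hJ.to_subtype
  have hsupp : ∀ {a : ι → ℂ} {c : ℂ}, (∀ j ∉ J, a j = 0) → HasSum a c →
      HasSum (fun j : J => a j) c := fun ha h =>
    (hasSum_subtype_iff_of_support_subset fun j hj => by
      by_contra h0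
      exact hj (ha j h0)).2 h
  have hmain := hasSum_integral_of_summable_integral_norm
    (F := fun (j : J) z => inner ℂ (f z) (b j) * inner ℂ (b j) (g z)) (fun j => hint j)
    (summable_of_sum_le (c := C * D * ν.real Set.univ)
      (fun j => integral_nonneg fun z => norm_nonneg _) fun s => by
        have := hsum (s.map (Function.Embedding.subtype _))
        rwa [Finset.sum_map] at this)
  have hval : ∀ z, ∑' j : J, inner ℂ (f z) (b j) * inner ℂ (b j) (g z) = inner ℂ (f z) (g z) :=
    fun z => (hsupp (fun j hj => by rw [hJ0 j hj, zero_mul])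
      (b.hasSum_inner_mul_inner (f z) (g z))).tsum_eq
  simp only [hval] at hmain
  refine (hasSum_subtype_iff_of_support_subset fun j hj => ?_).1 hmain
  by_contra h0
  refine hj ?_
  simp [hJ0 j h0]

/-- A strongly measurable family of bounded operators applied to a strongly measurable function
is strongly measurable. -/
theorem MeasureTheory.StronglyMeasurable.clm_family_apply {Z V W : Type*} [MeasurableSpace Z]
    [NormedAddCommGroup V] [NormedSpace ℂ V] [NormedAddCommGroup W] [NormedSpace ℂ W]
    {A : Z → V →L[ℂ] W} (hA : ∀ v, StronglyMeasurable fun z => A z v) {f : Z → V}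
    (hf : StronglyMeasurable f) : StronglyMeasurable fun z => A z (f z) := by
  have hs : ∀ g : SimpleFunc Z V, StronglyMeasurable fun z => A z (g z) := by
    intro g
    induction g using SimpleFunc.induction with
    | @const c s hs =>
      classical
      convert (hA c).indicator hs using 1
      funext z
      by_cases hz : z ∈ s <;> simp [hz]
    | @add f g _ hf hg =>
      simp only [SimpleFunc.coe_add, Pi.add_apply, map_add]
      exact hf.add hg
  refine stronglyMeasurable_of_tendsto atTop (fun n => hs (hf.approx n)) ?_
  rw [tendsto_pi_nhds]
  exact fun z => ((A z).continuous.tendsto _).comp (hf.tendsto_approx z)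

theorem tsum_tsum_eq_tsum_of_hasSum {ι κ : Type*} {c : ι → κ → ℂ} {d : ι → ℂ} {M : ι → ℝ}
    (hc : ∀ i, HasSum (c i) (d i)) (hM : Summable M)
    (hb : ∀ i (s : Finset κ), ∑ j ∈ s, ‖c i j‖ ≤ M i) : ∑' j, ∑' i, c i j = ∑' i, d i := by
  have h1 : ∀ i, Summable fun j => ‖c i j‖ := fun i =>
    summable_of_sum_le (fun _ => norm_nonneg _) (hb i)
  have h2 : Summable fun p : ι × κ => ‖c p.1 p.2‖ := by
    rw [summable_prod_of_nonneg fun _ => norm_nonneg _]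
    refine ⟨h1, Summable.of_nonneg_of_le (fun i => tsum_nonneg fun _ => norm_nonneg _)
      (fun i => ?_) hM⟩
    exact (h1 i).tsum_le_of_sum_le (hb i)
  have h3 : Summable (Function.uncurry c) := h2.of_norm
  rw [h3.tsum_comm]
  exact tsum_congr fun i => (hc i).tsum_eq

/-! ### Averages `∫ A(z) T B(z) dν(z)` and their trace duality. -/

section Average

variable {H K Z : Type*} [NormedAddCommGroup H] [InnerProductSpace ℂ H] [CompleteSpace H]
  [NormedAddCommGroup K] [InnerProductSpace ℂ K] [MeasurableSpace Z]

/-- Bounded families of operators which, together with the adjoints on the left, depend strongly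
measurably on a parameter. -/
structure IsMeasurableFamily (A : Z → H →L[ℂ] H) (B : Z → K →L[ℂ] K) (a b : ℝ) : Prop where
  left : ∀ v, StronglyMeasurable fun z => A z v
  adjoint_left : ∀ v, StronglyMeasurable fun z => ContinuousLinearMap.adjoint (A z) v
  norm_left : ∀ z, ‖A z‖ ≤ a
  right : ∀ v, StronglyMeasurable fun z => B z v
  norm_right : ∀ z, ‖B z‖ ≤ b

namespace IsMeasurableFamily

variable {A : Z → H →L[ℂ] H} {B : Z → K →L[ℂ] K} {a b : ℝ}

theorem stronglyMeasurable (h : IsMeasurableFamily A B a b) (T : K →L[ℂ] H) (v : K) :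
    StronglyMeasurable fun z => A z (T (B z v)) :=
  (T.continuous.comp_stronglyMeasurable (h.right v)).clm_family_apply h.left

theorem norm_apply_le (h : IsMeasurableFamily A B a b) (T : K →L[ℂ] H) (v : K) (z : Z) :
    ‖A z (T (B z v))‖ ≤ a * (‖T‖ * (b * ‖v‖)) := by
  have ha : 0 ≤ a := (norm_nonneg _).trans (h.norm_left z)
  refine ((A z).le_of_opNorm_le (h.norm_left z) _).trans ?_
  gcongr
  refine (T.le_opNorm _).trans ?_
  gcongr
  exact (B z).le_of_opNorm_le (h.norm_right z) _

theorem integrable (h : IsMeasurableFamily A B a b) (ν : Measure Z) [IsFiniteMeasure ν]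
    (T : K →L[ℂ] H) (v : K) : Integrable (fun z => A z (T (B z v))) ν :=
  Integrable.of_bound (h.stronglyMeasurable T v).aestronglyMeasurable _
    (Eventually.of_forall (h.norm_apply_le T v))

/-- The average `T ↦ ∫ A(z) T B(z) dν(z)`, as a linear map on bounded operators. -/
theorem exists_average (h : IsMeasurableFamily A B a b) (ν : Measure Z) [IsFiniteMeasure ν] :
    ∃ D : (K →L[ℂ] H) →ₗ[ℂ] (K →L[ℂ] H), ∀ T v, D T v = ∫ z, A z (T (B z v)) ∂ν := by
  let D₀ : (K →L[ℂ] H) → K →L[ℂ] H := fun T => LinearMap.mkContinuous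
    { toFun := fun v => ∫ z, A z (T (B z v)) ∂ν
      map_add' := fun v v' => by
        simp only [map_add]
        exact integral_add (h.integrable ν T v) (h.integrable ν T v')
      map_smul' := fun c v => by
        simp only [map_smul, RingHom.id_apply]
        exact integral_smul c _ }
    (a * (‖T‖ * b) * ν.real Set.univ) (fun v => by
      refine (norm_integral_le_of_norm_le_const
        (Eventually.of_forall (h.norm_apply_le T v))).trans_eq ?_
      ring)
  exact ⟨{ toFun := D₀
           map_add' := fun S T => by
             ext v
             change ∫ z, A z (S (B z v) + T (B z v)) ∂ν = _
             simp only [map_add]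
             exact integral_add (h.integrable ν S v) (h.integrable ν T v)
           map_smul' := fun c T => by
             ext v
             change ∫ z, A z (c • T (B z v)) ∂ν = _
             simp only [map_smul]
             exact integral_smul c _ }, fun _ _ => rfl⟩

theorem inner_average (h : IsMeasurableFamily A B a b) (ν : Measure Z) [IsFiniteMeasure ν]
    {D : (K →L[ℂ] H) →ₗ[ℂ] (K →L[ℂ] H)} (hD : ∀ T v, D T v = ∫ z, A z (T (B z v)) ∂ν)
    (T : K →L[ℂ] H) (u : H) (v : K) :
    inner ℂ u (D T v) = ∫ z, inner ℂ u (A z (T (B z v))) ∂ν := by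
  rw [hD]
  exact (integral_inner (h.integrable ν T v) u).symm

theorem inner_average_rankOne (h : IsMeasurableFamily A B a b) (ν : Measure Z) [IsFiniteMeasure ν]
    {D : (K →L[ℂ] H) →ₗ[ℂ] (K →L[ℂ] H)} (hD : ∀ T v, D T v = ∫ z, A z (T (B z v)) ∂ν)
    (s x : H) (k v : K) :
    inner ℂ s (D (InnerProductSpace.rankOne ℂ x k) v) =
      ∫ z, inner ℂ s (A z x) * inner ℂ k (B z v) ∂ν := by
  rw [h.inner_average ν hD]
  refine integral_congr_ae (Eventually.of_forall fun z => ?_)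
  simp only [InnerProductSpace.rankOne_apply, map_smul, inner_smul_right]
  rw [mul_comm]

/-- Pointwise convergence of a sequence bounds `‖T n‖` by Banach-Steinhaus, which supplies a
constant dominating function on the finite measure space. Both tools are the reason for sequences
rather than nets. -/
theorem tendsto_average [CompleteSpace K] (h : IsMeasurableFamily A B a b) (ν : Measure Z) [IsFiniteMeasure ν]
    {D : (K →L[ℂ] H) →ₗ[ℂ] (K →L[ℂ] H)} (hD : ∀ T v, D T v = ∫ z, A z (T (B z v)) ∂ν)
    {T : ℕ → K →L[ℂ] H} {T₀ : K →L[ℂ] H}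
    (hT : ∀ v, Tendsto (fun n => T n v) atTop (𝓝 (T₀ v))) (v : K) :
    Tendsto (fun n => D (T n) v) atTop (𝓝 (D T₀ v)) := by
  obtain ⟨M, hM⟩ := banach_steinhaus (g := T) fun v => by
    obtain ⟨M, hM⟩ := (Metric.isBounded_range_of_tendsto _ (hT v)).exists_norm_le
    exact ⟨M, fun n => hM _ ⟨n, rfl⟩⟩
  simp only [hD]
  refine tendsto_integral_of_dominated_convergence (fun _ => a * (M * (b * ‖v‖)))
    (fun n => (h.stronglyMeasurable (T n) v).aestronglyMeasurable) (integrable_const _)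
    (fun n => Eventually.of_forall fun z => ?_)
    (Eventually.of_forall fun z => ((A z).continuous.tendsto _).comp (hT _))
  have ha : 0 ≤ a := (norm_nonneg _).trans (h.norm_left z)
  have hb : 0 ≤ b := (norm_nonneg _).trans (h.norm_right z)
  refine (h.norm_apply_le (T n) v z).trans ?_
  gcongr
  exact hM n

end IsMeasurableFamily

namespace HilbertSchmidt

/-- Polarization: a bounded operator on the Hilbert-Schmidt operators is determined by its
quadratic form on rank-one operators. -/
theorem inner_rankOne_eq_of_diag {P : HilbertSchmidt H K →L[ℂ] HilbertSchmidt H K}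
    {D : (K →L[ℂ] H) →ₗ[ℂ] (K →L[ℂ] H)}
    (h : ∀ w s, inner ℂ (rankOne w s) (P (rankOne w s)) =
      inner ℂ s (D (InnerProductSpace.rankOne ℂ s w) w)) (k w : K) (s x : H) :
    inner ℂ (rankOne k x) (P (rankOne w s)) =
      inner ℂ s (D (InnerProductSpace.rankOne ℂ x k) w) := by
  have h1 : ∀ (k w : K) (s : H), inner ℂ (rankOne k s) (P (rankOne w s)) -
      inner ℂ s (D (InnerProductSpace.rankOne ℂ s k) w) = 0 := by
    intro k w s
    refine sesquilinear_eq_zero_of_diag (fun k w => inner ℂ (rankOne k s) (P (rankOne w s)) -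
      inner ℂ s (D (InnerProductSpace.rankOne ℂ s k) w)) ?_ ?_ ?_ ?_ ?_ k w
    · intro u u' v
      simp only [rankOne_add_left, inner_add_left, map_add, add_apply, inner_add_right]
      ring
    · intro u v v'
      simp only [rankOne_add_left, map_add, inner_add_right]
      ring
    · intro c u v
      simp only [rankOne_smul_left, inner_smul_left, map_smulₛₗ, smul_apply, inner_smul_right,
        RingHom.id_apply]
      ring
    · intro c u v
      simp only [rankOne_smul_left, map_smul, inner_smul_right]
      ring
    · intro v
      exact sub_eq_zero.2 (h v s)
  refine sub_eq_zero.1 (sesquilinear_eq_zero_of_diag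
    (fun s x => inner ℂ (rankOne k x) (P (rankOne w s)) -
      inner ℂ s (D (InnerProductSpace.rankOne ℂ x k) w)) ?_ ?_ ?_ ?_ ?_ s x)
  · intro u u' v
    simp only [rankOne_add_right, inner_add_left, map_add, inner_add_right]
    ring
  · intro u v v'
    simp only [rankOne_add_right, inner_add_left, map_add, add_apply, inner_add_right]
    ring
  · intro c u v
    simp only [rankOne_smul_right, map_smul, inner_smul_right, inner_smul_left]
    ring
  · intro c u v
    simp only [rankOne_smul_right, map_smul, smul_apply, inner_smul_right, inner_smul_left,
      Complex.conj_conj]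
    ring
  · intro v
    exact h1 k w v

variable [CompleteSpace K]

theorem opTrace_rankOne_comp (w : K) (s : H) (D : K →L[ℂ] H) :
    opTrace (InnerProductSpace.rankOne ℂ w s ∘L D) = inner ℂ s (D w) := by
  rw [opTrace, ← ContinuousLinearMap.adjoint_inner_left,
    ← (stdBasis K).tsum_inner_mul_inner]
  refine tsum_congr fun j => ?_
  rw [ContinuousLinearMap.comp_apply, InnerProductSpace.rankOne_apply, inner_smul_right,
    ContinuousLinearMap.adjoint_inner_left]

theorem opTrace_comp_of_hasSum_rankOne {ι : Type*} {R : HilbertSchmidt H K} {x : ι → K}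
    {y : ι → H} (hs : Summable fun i => ‖x i‖ * ‖y i‖)
    (hR : HasSum (fun i => rankOne (x i) (y i)) R) (D : K →L[ℂ] H) :
    opTrace (toCLM R ∘L D) = ∑' i, inner ℂ (y i) (D (x i)) := by
  have hterm : ∀ j, inner ℂ (stdBasis K j) ((toCLM R ∘L D) (stdBasis K j)) =
      ∑' i, inner ℂ (ContinuousLinearMap.adjoint D (y i)) (stdBasis K j) *
        inner ℂ (stdBasis K j) (x i) := by
    intro j
    have h1 := ((hR.mapL toCLML).mapL (ContinuousLinearMap.apply ℂ K (D (stdBasis K j)))).mapL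
      (innerSL ℂ (stdBasis K j))
    refine h1.tsum_eq.symm.trans (tsum_congr fun i => ?_)
    simp [ContinuousLinearMap.adjoint_inner_left]
  rw [opTrace]
  simp only [hterm]
  -- Integrating against a point mass specializes the lemma to constant functions: plain Parseval
  -- together with a bound on finite absolute sums.
  have hP := fun i => (stdBasis K).hasSum_integral_inner_mul_inner (Measure.dirac ())
    (f := fun _ => ContinuousLinearMap.adjoint D (y i)) (g := fun _ => x i)
    stronglyMeasurable_const stronglyMeasurable_const (fun _ => le_rfl) (fun _ => le_rfl)
  simp only [integral_const, probReal_univ, one_smul, mul_one] at hP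
  have := tsum_tsum_eq_tsum_of_hasSum (M := fun i => ‖D‖ * (‖x i‖ * ‖y i‖)) (fun i => (hP i).2)
    (hs.mul_left _) fun i s => ((hP i).1 s).trans (by
      calc ‖ContinuousLinearMap.adjoint D (y i)‖ * ‖x i‖
          ≤ ‖ContinuousLinearMap.adjoint D‖ * ‖y i‖ * ‖x i‖ := by
            gcongr
            exact ContinuousLinearMap.le_opNorm _ _
        _ = ‖D‖ * (‖x i‖ * ‖y i‖) := by
            rw [LinearIsometryEquiv.norm_map]
            ring)
  rw [this]
  exact tsum_congr fun i => ContinuousLinearMap.adjoint_inner_left _ _ _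

end HilbertSchmidt

variable [CompleteSpace K]

open HilbertSchmidt in
/-- Trace duality between `T ↦ ∫ A(z) T B(z) dν(z)` and a bounded operator on the Hilbert-Schmidt
operators which acts on rank-one operators as `R ↦ ∫ B(z) R A(z) dν(z)`. -/
theorem IsMeasurableFamily.opTrace_average {A : Z → H →L[ℂ] H} {B : Z → K →L[ℂ] K} {a b : ℝ}
    (h : IsMeasurableFamily A B a b) (ν : Measure Z) [IsFiniteMeasure ν]
    {D : (K →L[ℂ] H) →ₗ[ℂ] (K →L[ℂ] H)} (hD : ∀ T v, D T v = ∫ z, A z (T (B z v)) ∂ν)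
    {P : HilbertSchmidt H K →L[ℂ] HilbertSchmidt H K}
    (hP : ∀ w s, inner ℂ (rankOne w s) (P (rankOne w s)) =
      inner ℂ s (D (InnerProductSpace.rankOne ℂ s w) w))
    (T : K →L[ℂ] H) {R : HilbertSchmidt H K} (hR : IsTraceClass (toCLM R)) :
    opTrace (toCLM R ∘L D T) = opTrace (T ∘L toCLM (P R)) := by
  obtain ⟨x, y, hs, hxy⟩ := exists_hasSum_rankOne_of_isTraceClass hR
  rw [opTrace_comp_of_hasSum_rankOne hs hxy, opTrace]
  have hterm : ∀ j, inner ℂ (stdBasis H j) ((T ∘L toCLM (P R)) (stdBasis H j)) =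
      ∑' i, ∫ z, inner ℂ (ContinuousLinearMap.adjoint (A z) (y i)) (stdBasis H j) *
        inner ℂ (stdBasis H j) (T (B z (x i))) ∂ν := by
    intro j
    -- Pairing with `|T* e_j⟩⟨e_j|` extracts `⟪e_j, T (P R) e_j⟫`, so the expansion of `R` passes
    -- through `P` by continuity in the Hilbert-Schmidt norm.
    have h1 := ((hxy.mapL P).mapL (innerSL ℂ
      (rankOne (ContinuousLinearMap.adjoint T (stdBasis H j)) (stdBasis H j))))
    simp only [innerSL_apply_apply] at h1
    rw [inner_rankOne_left, ContinuousLinearMap.adjoint_inner_left] at h1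
    rw [ContinuousLinearMap.comp_apply, ← h1.tsum_eq]
    refine tsum_congr fun i => ?_
    rw [inner_rankOne_eq_of_diag hP, h.inner_average_rankOne ν hD]
    simp only [ContinuousLinearMap.adjoint_inner_left]
  simp only [hterm]
  have ha : ∀ i z, ‖ContinuousLinearMap.adjoint (A z) (y i)‖ ≤ a * ‖y i‖ := fun i z =>
    ContinuousLinearMap.le_of_opNorm_le _
      ((LinearIsometryEquiv.norm_map _ _).trans_le (h.norm_left z)) _
  have hb : ∀ i z, ‖T (B z (x i))‖ ≤ ‖T‖ * (b * ‖x i‖) := fun i z => by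
    refine (T.le_opNorm _).trans ?_
    gcongr
    exact (B z).le_of_opNorm_le (h.norm_right z) _
  have hL := fun i => (stdBasis H).hasSum_integral_inner_mul_inner ν
    (h.adjoint_left (y i)) (T.continuous.comp_stronglyMeasurable (h.right (x i)))
    (ha i) (hb i)
  rw [tsum_tsum_eq_tsum_of_hasSum (M := fun i => a * ‖T‖ * b * ν.real Set.univ *
    (‖x i‖ * ‖y i‖)) (fun i => (hL i).2) (hs.mul_left _)
    fun i s => ((hL i).1 s).trans_eq (by ring)]
  refine tsum_congr fun i => ?_
  rw [h.inner_average ν hD]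
  simp only [ContinuousLinearMap.adjoint_inner_left]

end Average

/-! ### Double operator integrals of decomposable symbols. -/

section DoubleOperatorIntegral

open HilbertSchmidt

variable {X Y Z : Type*} [MeasurableSpace X] [MeasurableSpace Y] [MeasurableSpace Z]
  {H K : Type*} [NormedAddCommGroup H] [InnerProductSpace ℂ H] [CompleteSpace H]
  [NormedAddCommGroup K] [InnerProductSpace ℂ K] [CompleteSpace K]

theorem PVM.isMeasurableFamily_integral (E : PVM X H) (F : PVM Y K) {α : X × Z → ℂ}
    {β : Y × Z → ℂ} (hα : Measurable α) (hβ : Measurable β) {a b : ℝ} (ha0 : 0 ≤ a)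
    (hb0 : 0 ≤ b) (ha : ∀ p, ‖α p‖ ≤ a) (hb : ∀ p, ‖β p‖ ≤ b) :
    IsMeasurableFamily (fun z => E.integral fun x => α (x, z))
      (fun z => F.integral fun y => β (y, z)) (2 * a) (2 * b) where
  left := E.stronglyMeasurable_integral hα ha
  adjoint_left v := by
    have h : ∀ z, ContinuousLinearMap.adjoint (E.integral fun x => α (x, z)) =
        E.integral fun x => starRingEnd ℂ (α (x, z)) := fun z =>
      E.adjoint_integral (hα.comp measurable_prodMk_right) fun x => ha (x, z)
    simp only [h]
    exact E.stronglyMeasurable_integral (α := fun p => starRingEnd ℂ (α p))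
      (Complex.continuous_conj.measurable.comp hα) (fun p => by simpa using ha p) v
  norm_left z := E.norm_integral_le (hα.comp measurable_prodMk_right) ha0 fun x => ha (x, z)
  right := F.stronglyMeasurable_integral hβ hb
  norm_right z := F.norm_integral_le (hβ.comp measurable_prodMk_right) hb0 fun y => hb (y, z)

variable [Nonempty X] [Nonempty Y] {E : PVM X H} {F : PVM Y K}

/-- A null set of the double measure is null for each of its diagonal measures, and on rank-one
operators these are products. The decomposition, stated for `doublePVM E F`, thereby becomes usable
for the transposed measure. -/
theorem PVM.AlmostEverywhere.ae_prod_diag {p : X × Y → Prop}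
    (h : (doublePVM E F).AlmostEverywhere p) (x : H) (y : K) :
    ∀ᵐ q ∂(E.diag x).prod (F.diag y), p q := by
  obtain ⟨N, hN, h0, hp⟩ := h
  rw [← (PVM.isDoublePVM_doublePVM E F).diag_rankOne]
  have hN0 : (doublePVM E F).diag (rankOne x y) N = 0 := by
    rw [PVM.diag_apply _ _ hN, h0]
    simp
  exact measure_mono_null (fun q hq => by_contra fun hqN => hq (hp q hqN)) hN0

/-- The quadratic form on rank-one operators of the transposed double operator integral. -/
theorem IsDecomposition.inner_rankOne_integral {φ : X × Y → ℂ} {ν : Measure Z} {α : X × Z → ℂ}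
    {β : Y × Z → ℂ} (hd : IsDecomposition E F φ ν α β) (hφ : Measurable φ) {C : ℝ}
    (hC : ∀ p, ‖φ p‖ ≤ C) (w : K) (s : H) :
    inner ℂ (rankOne w s) ((doublePVM F E).integral (φ ∘ Prod.swap) (rankOne w s)) =
      ∫ z, inner ℂ s (E.integral (fun x => α (x, z)) s) *
        inner ℂ w (F.integral (fun y => β (y, z)) w) ∂ν := by
  obtain ⟨a, ha⟩ := hd.bounded_left
  obtain ⟨b, hb⟩ := hd.bounded_right
  have hν := hd.finite
  have hE : ∀ z, inner ℂ s (E.integral (fun x => α (x, z)) s) = ∫ x, α (x, z) ∂E.diag s :=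
    fun z => E.isIntegral_integral (hd.measurable_left.comp measurable_prodMk_right)
      (fun x => ha (x, z)) s
  have hF : ∀ z, inner ℂ w (F.integral (fun y => β (y, z)) w) = ∫ y, β (y, z) ∂F.diag w :=
    fun z => F.isIntegral_integral (hd.measurable_right.comp measurable_prodMk_right)
      (fun y => hb (y, z)) w
  have hm : Measurable fun q : (X × Y) × Z => α (q.1.1, q.2) * β (q.1.2, q.2) :=
    (hd.measurable_left.comp (by fun_prop)).mul (hd.measurable_right.comp (by fun_prop))
  rw [(doublePVM F E).isIntegral_integral (hφ.comp measurable_swap) (fun p => hC _),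
    (PVM.isDoublePVM_doublePVM F E).diag_rankOne]
  simp only [Function.comp_def, hE, hF]
  -- Swapping coordinates moves the integral from `F_{w,w} × E_{s,s}` to `E_{s,s} × F_{w,w}`, where
  -- the decomposition holds almost everywhere. Fubini then puts `z` outside, and the inner integral
  -- factors.
  rw [integral_prod_swap (fun q : X × Y => φ q), integral_congr_ae (hd.eq_integral.ae_prod_diag s w),
    integral_integral_swap (f := fun (p : X × Y) z => α (p.1, z) * β (p.2, z))]
  · exact integral_congr_ae (Eventually.of_forall fun z =>
      integral_prod_mul (fun x => α (x, z)) fun y => β (y, z))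
  · refine Integrable.of_bound hm.aestronglyMeasurable (a * b) (Eventually.of_forall fun q => ?_)
    rw [Function.uncurry_apply_pair, norm_mul]
    exact mul_le_mul (ha _) (hb _) (norm_nonneg _) ((norm_nonneg _).trans (ha (q.1.1, q.2)))

theorem IsDoubleOperatorIntegral.unique {φ : X × Y → ℂ} {T D D' : K →L[ℂ] H}
    (h : IsDoubleOperatorIntegral E F φ T D) (h' : IsDoubleOperatorIntegral E F φ T D') :
    D = D' := by
  ext v
  refine ext_inner_left ℂ fun u => ?_
  have hR : IsTraceClass (toCLM (rankOne v u)) := isTraceClass_rankOne v u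
  rw [← opTrace_rankOne_comp, ← opTrace_rankOne_comp, ← toCLM_rankOne]
  exact (h _ hR).trans (h' _ hR).symm

end DoubleOperatorIntegral

end

theorem mainTheorem8
    {X : Type u₁} {Y : Type u₂} [MeasurableSpace X] [MeasurableSpace Y] [Nonempty X] [Nonempty Y]
    {H : Type u₃} {K : Type u₄}
    [NormedAddCommGroup H] [InnerProductSpace ℂ H] [CompleteSpace H]
    [NormedAddCommGroup K] [InnerProductSpace ℂ K] [CompleteSpace K]
    (E : PVM X H) (F : PVM Y K) (φ : X × Y → ℂ)
    (hφ : MemIntegralProjective.{w, u₁, u₂, u₃, u₄} E F φ) :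
    (∀ T : K →L[ℂ] H, ∃! D : K →L[ℂ] H, IsDoubleOperatorIntegral E F φ T D) ∧
    ∀ (T : ℕ → K →L[ℂ] H) (T₀ : K →L[ℂ] H),
      (∀ v : K, Tendsto (fun n => T n v) atTop (𝓝 (T₀ v))) →
      ∀ v : K, Tendsto (fun n => doubleOperatorIntegral E F φ (T n) v) atTop
        (𝓝 (doubleOperatorIntegral E F φ T₀ v)) := by
  obtain ⟨hm, ⟨C, hC⟩, Z, mZ, ν, α, β, hd⟩ := hφ
  obtain ⟨a, ha⟩ := hd.bounded_left
  obtain ⟨b, hb⟩ := hd.bounded_right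
  have hν := hd.finite
  -- The maximum with 0 is needed because `Z` may be empty, in which case the given bounds can be
  -- negative.
  have hfam := E.isMeasurableFamily_integral F hd.measurable_left hd.measurable_right
    (le_max_right a 0) (le_max_right b 0) (fun p => (ha p).trans (le_max_left _ _))
    fun p => (hb p).trans (le_max_left _ _)
  obtain ⟨D, hD⟩ := hfam.exists_average ν
  have hint : ∀ T, IsDoubleOperatorIntegral E F φ T (D T) := fun T R hR =>
    hfam.opTrace_average ν hD (fun w s => by
      rw [hd.inner_rankOne_integral hm hC, hfam.inner_average_rankOne ν hD]) T hR
  -- The integral is an arbitrary choice among operators satisfying the duality; uniqueness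
  -- identifies it with the average.
  have heq : ∀ T, doubleOperatorIntegral E F φ T = D T := fun T =>
    (Classical.epsilon_spec (p := IsDoubleOperatorIntegral E F φ T) ⟨D T, hint T⟩).unique (hint T)
  refine ⟨fun T => ⟨D T, hint T, fun D' hD' => hD'.unique (hint T)⟩, fun T T₀ hT v => ?_⟩
  simp only [heq]
  exact hfam.tendsto_average ν hD hT v
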